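/- Let $k\ge 0$ and $N\ge 3$ be integers, let $\mathbf H\subset\mathbb C$ be the upper half-plane, and let $\Gamma(N)$ be the kernel of $SL_2(\mathbb Z)\to SL_2(\mathbb Z/N)$. For a field $K$ of characteristic $0$ let $\mathrm{Sym}^k(K^2)$ have the basis $\mathbf e_1^i\mathbf e_2^{k-i}$, $0\le i\le k$, where $g=\begin{pmatrix}a&b\\c&d\end{pmatrix}$ acts by $g\cdot\mathbf e_1=a\mathbf e_1+c\mathbf e_2$ and $g\cdot\mathbf e_2=b\mathbf e_1+d\mathbf e_2$; put $\mathbf V_k=\mathrm{Sym}^k(\mathbb Q^2)$, so $\mathbf V_k\otimes\mathbb C=\mathrm{Sym}^k(\mathbb C^2)$, and let $\mathbb V_k$ be the corresponding local system on $\mathbf H/\Gamma(N)$. The group $SL_2(\mathbb R)$ acts on $\mathbf V_k\otimes\mathbb C$-valued functions on $\mathbf H$ by $(g\cdot f)(z)=g\cdot f(g^{-1}z)$ and on $\mathbf V_k\otimes\mathbb C$-valued 1-forms $\omega=\sum_i \mathbf e_1^i\mathbf e_2^{k-i}\otimes\omega_i$ on $\mathbf H$ by $g\cdot\omega=\sum_i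 g\cdot(\mathbf e_1^i\mathbf e_2^{k-i})\otimes(g^{-1})^*\omega_i$. Let $H^1(\mathbf H/\Gamma(N),\mathbb V_k\otimes\mathbb C)$ be the space of smooth closed $\Gamma(N)$-invariant $\mathbf V_k\otimes\mathbb C$-valued 1-forms on $\mathbf H$ modulo the forms $df$ with $f:\mathbf H\to\mathbf V_k\otimes\mathbb C$ smooth and $\Gamma(N)$-invariant, with the action of $SL_2(\mathbb Z/N)$ given by $\omega\mapsto g\cdot\omega$ for any lift $g\in SL_2(\mathbb Z)$, and with the rational structure given by the image of the (Čech) cohomology $H^1(\mathbf H/\Gamma(N),\mathbb V_k)$ of the rational local system. Let $H^1(\Gamma(N),\mathbf V_k\otimes\mathbb C)$ be group cohomology, with the action of $SL_2(\mathbb Z/N)$ given on cocycles by $(g\cdot F)(\gamma)=g\cdot F(g^{-1}\gamma g)$ for any lift $g\in SL_2(\mathbb Z)$, and with the rational structure given by the image of $H^1(\Gamma(N),\mathbf V_k)$. Fix $z_0\in\mathbf H$. For a smooth closed $\mathbf V_k\otimes\mathbb C$-valued 1-form $\omega$ on $\mathbf H$ and $a,b\in\mathbf H$, let $\int_a^b\omega$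 be the (coefficientwise) integral along the straight segment from $a$ to $b$, and put $\mathbf S_\omega(\gamma)=\int_{z_0}^{\gamma z_0}\omega$ for $\gamma\in\Gamma(N)$. Then: 1. $\int_a^b\omega$ equals the integral of $\omega$ along every $C^1$ path in $\mathbf H$ from $a$ to $b$. 2. If $\omega$ is $\Gamma(N)$-invariant, then $\mathbf S_\omega$ is a 1-cocycle, i.e. $\mathbf S_\omega(\gamma\gamma')=\mathbf S_\omega(\gamma)+\gamma\cdot\mathbf S_\omega(\gamma')$. 3. If $\omega=df$ for a smooth $\Gamma(N)$-invariant function $f:\mathbf H\to\mathbf V_k\otimes\mathbb C$, then $\mathbf S_\omega$ is a 1-coboundary. 4. The map $\omega\mapsto\mathbf S_\omega$ induces an $SL_2(\mathbb Z/N)$-equivariant $\mathbb C$-linear isomorphism $$\mathbf S^*:H^1(\mathbf H/\Gamma(N),\mathbb V_k\otimes\mathbb C)\to H^1(\Gamma(N),\mathbf V_k\otimes\mathbb C),$$ and it is defined over $\mathbb Q$: it maps the rational structure of the source onto that of the target. -/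

import Mathlib

open scoped MatrixGroups Topology
open UpperHalfPlane Matrix.SpecialLinearGroup

noncomputable section
namespace SymCoh

/-- The module `Sym^k (R²)` in coordinates: the vector `v` stands for `∑ i, v i • e₁ ^ i * e₂ ^ (k - i)`.
For `R = ℚ` this is `V_k`, for `R = ℂ` it is `V_k ⊗ ℂ`. -/
abbrev V (k : ℕ) (R : Type*) : Type _ := Fin (k + 1) → R

section Sym
variable (R : Type*) [CommRing R] (k : ℕ)

/-- Exponent of the monomial `e₁ ^ i * e₂ ^ (k - i)`, where `e₁ = X 0` and `e₂ = X 1`. -/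
def mon (i : Fin (k + 1)) : Fin 2 →₀ ℕ :=
  Finsupp.single 0 (i : ℕ) + Finsupp.single 1 (k - (i : ℕ))

lemma mon_zero (i : Fin (k + 1)) : mon k i 0 = i := by simp [mon]

lemma mon_injective : Function.Injective (mon k) := fun i j h => by
  ext; rw [← mon_zero k i, h, mon_zero]

lemma exists_mon {m : Fin 2 →₀ ℕ} (h : m.degree = k) : ∃ i, mon k i = m := by
  have h2 : m 0 + m 1 = k := by simpa [Finsupp.degree_eq_sum, Fin.sum_univ_two] using h
  refine ⟨⟨m 0, by omega⟩, ?_⟩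
  ext j; fin_cases j
  · simp [mon]
  · simp [mon]; omega

lemma degree_mon (i : Fin (k + 1)) : (mon k i).degree = k := by
  have := i.2
  rw [Finsupp.degree_eq_sum, Fin.sum_univ_two]
  simp [mon]; omega

/-- `Sym^k (R²)` as the degree `k` part of the polynomial ring in `e₁ = X 0`, `e₂ = X 1`. -/
def equivPoly : V k R ≃ₗ[R] MvPolynomial.homogeneousSubmodule (Fin 2) R k where
  toFun v := ⟨∑ i, MvPolynomial.monomial (mon k i) (v i),
    Submodule.sum_mem _ fun i _ => MvPolynomial.isHomogeneous_monomial _ (degree_mon k i)⟩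
  invFun p i := MvPolynomial.coeff (mon k i) p.1
  map_add' v w := by ext1; simp [Finset.sum_add_distrib]
  map_smul' c v := by ext1; simp [Finset.smul_sum, MvPolynomial.smul_monomial]
  left_inv v := by
    ext i
    simp [MvPolynomial.coeff_sum, MvPolynomial.coeff_monomial, (mon_injective k).eq_iff]
  right_inv p := by
    ext m
    simp only [MvPolynomial.coeff_sum, MvPolynomial.coeff_monomial]
    by_cases hm : m.degree = k
    · obtain ⟨i, rfl⟩ := exists_mon k hm
      simp [(mon_injective k).eq_iff]
    · have hp : (p : MvPolynomial (Fin 2) R).IsHomogeneous k := p.2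
      rw [hp.coeff_eq_zero hm]
      refine Finset.sum_eq_zero fun i _ => if_neg ?_
      rintro rfl
      exact hm (degree_mon k i)

/-- The algebra endomorphism `e_j ↦ ∑ i, g i j • e_i`; for `g = (a b; c d)` it is
`e₁ ↦ a e₁ + c e₂`, `e₂ ↦ b e₁ + d e₂`. -/
def substAlg (g : Matrix (Fin 2) (Fin 2) R) :
    MvPolynomial (Fin 2) R →ₐ[R] MvPolynomial (Fin 2) R :=
  MvPolynomial.aeval fun j => ∑ i, MvPolynomial.C (g i j) * MvPolynomial.X i

lemma substAlg_one : substAlg R 1 = AlgHom.id R _ := by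
  ext j : 1
  simp [substAlg, Matrix.one_apply]

lemma substAlg_mul (g h : Matrix (Fin 2) (Fin 2) R) :
    substAlg R (g * h) = (substAlg R g).comp (substAlg R h) := by
  ext j : 1
  simp [substAlg, Matrix.mul_apply, Fin.sum_univ_two]
  simp only [← MvPolynomial.algebraMap_eq]
  simp
  ring

lemma substAlg_mem (g : Matrix (Fin 2) (Fin 2) R) (p : MvPolynomial (Fin 2) R)
    (hp : p ∈ MvPolynomial.homogeneousSubmodule (Fin 2) R k) :
    substAlg R g p ∈ MvPolynomial.homogeneousSubmodule (Fin 2) R k := by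
  have hp' : p.IsHomogeneous k := hp
  have := hp'.aeval (n := 1) (fun j => ∑ i, MvPolynomial.C (g i j) * MvPolynomial.X i)
    (fun j => MvPolynomial.IsHomogeneous.sum _ _ _ fun i _ => MvPolynomial.isHomogeneous_C_mul_X _ _)
  simpa [substAlg] using this

/-- `Sym^k` of the standard representation, on homogeneous polynomials. -/
def polyRep : Representation R SL(2, R) (MvPolynomial.homogeneousSubmodule (Fin 2) R k) where
  toFun g := (substAlg R g.1).toLinearMap.restrict fun p hp => substAlg_mem R k g.1 p hp
  map_one' := by
    ext1 p; ext1
    simp [LinearMap.restrict_apply, substAlg_one]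
  map_mul' g h := by
    ext1 p; ext1
    simp [LinearMap.restrict_apply, substAlg_mul, Module.End.mul_apply]
    rfl

/-- `Sym^k` of the standard representation of `SL(2, R)`, in coordinates. -/
def symRep : Representation R SL(2, R) (V k R) where
  toFun g := (equivPoly R k).symm.conj (polyRep R k g)
  map_one' := by simp [LinearEquiv.conj_id, Module.End.one_eq_id]
  map_mul' g h := by simp [Module.End.mul_eq_comp, LinearEquiv.conj_comp]

/-- The action of `SL(2, ℤ)` on `Sym^k (R²)`. -/
def symRepInt : Representation R SL(2, ℤ) (V k R) :=
  (symRep R k).comp (map (Int.castRingHom R))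

end Sym
/-- The inclusion of `SL(2, ℤ)` into `SL(2, ℝ)`. -/
def toReal : SL(2, ℤ) →* SL(2, ℝ) := map (Int.castRingHom ℝ)

lemma toReal_smul (γ : SL(2, ℤ)) (z : ℍ) : toReal γ • z = γ • z := by
  ext1
  rw [coe_specialLinearGroup_apply, coe_specialLinearGroup_apply]
  simp [toReal]

section Forms
variable (k : ℕ)

/-- `1`-forms on the upper half-plane with values in `V_k ⊗ ℂ` (no regularity yet). -/
abbrev OneForm : Type := ℍ → (ℂ →L[ℝ] V k ℂ)

/-- The action of `SL(2, ℝ)` on `V_k ⊗ ℂ`. -/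
def realRep : Representation ℂ SL(2, ℝ) (V k ℂ) :=
  (symRep ℂ k).comp (map Complex.ofRealHom)

lemma realRep_toReal (γ : SL(2, ℤ)) : realRep k (toReal γ) = symRepInt ℂ k γ := by
  simp only [realRep, symRepInt, toReal, MonoidHom.comp_apply]
  congr 1

def realRepL (g : SL(2, ℝ)) : V k ℂ →L[ℂ] V k ℂ := (realRep k g).toContinuousLinearMap

/-- The real derivative at `z` of the map `w ↦ g • w` of the upper half-plane. -/
def mobiusFDeriv (g : SL(2, ℝ)) (z : ℍ) : ℂ →L[ℝ] ℂ :=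
  fderiv ℝ (fun w : ℂ => ((g • ofComplex w : ℍ) : ℂ)) z

lemma hasFDerivAt_mobius (g : SL(2, ℝ)) (z : ℍ) :
    HasFDerivAt (fun w : ℂ => ((g • ofComplex w : ℍ) : ℂ)) (mobiusFDeriv g z) z :=
  (hasStrictFDerivAt_smul (mapGL ℝ g) z).hasFDerivAt.differentiableAt.hasFDerivAt

lemma mobiusFDeriv_one (z : ℍ) : mobiusFDeriv 1 z = ContinuousLinearMap.id ℝ ℂ := by
  refine (hasFDerivAt_mobius 1 z).unique ?_
  refine (hasFDerivAt_id (z : ℂ)).congr_of_eventuallyEq ?_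
  filter_upwards [eventuallyEq_coe_comp_ofComplex z.im_pos] with w hw
  simpa using hw

lemma mobiusFDeriv_mul (g h : SL(2, ℝ)) (z : ℍ) :
    mobiusFDeriv (g * h) z = (mobiusFDeriv g (h • z)).comp (mobiusFDeriv h z) := by
  refine (hasFDerivAt_mobius (g * h) z).unique ?_
  have h1 := hasFDerivAt_mobius h z
  have h2 := hasFDerivAt_mobius g (h • z)
  have e : ((h • z : ℍ) : ℂ) = (fun w : ℂ => ((h • ofComplex w : ℍ) : ℂ)) z := by simp
  rw [e] at h2
  refine (h2.comp (z : ℂ) h1).congr_of_eventuallyEq (Filter.Eventually.of_forall fun w => ?_)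
  simp [mul_smul]

/-- The action of `SL(2, ℝ)` on `1`-forms: `g · (v ⊗ α) = (g · v) ⊗ (g⁻¹)^* α`. -/
def formRep : Representation ℂ SL(2, ℝ) (OneForm k) where
  toFun g :=
    { toFun := fun ω z => ((realRepL k g).restrictScalars ℝ).comp
        ((ω (g⁻¹ • z)).comp (mobiusFDeriv g⁻¹ z))
      map_add' := fun ω η => by
        funext z; ext v : 1; simp
      map_smul' := fun c ω => by
        funext z; ext v : 1; simp }
  map_one' := by
    ext1 ω; funext z; ext v : 1
    simp [realRepL, mobiusFDeriv_one]
  map_mul' g h := by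
    ext1 ω; funext z; ext v : 1
    simp [realRepL, mobiusFDeriv_mul, mul_smul]

/-- The action of `SL(2, ℝ)` on functions: `(g · f)(z) = g · f (g⁻¹ z)`. -/
def funRep : Representation ℂ SL(2, ℝ) (ℍ → V k ℂ) where
  toFun g :=
    { toFun := fun f z => realRep k g (f (g⁻¹ • z))
      map_add' := fun f f' => by funext z; simp
      map_smul' := fun c f => by funext z; simp }
  map_one' := by ext1 f; funext z; simp
  map_mul' g h := by ext1 f; funext z; simp [mul_smul]

/-- `f` is `C^∞` (in the real sense) on the upper half-plane. -/
def SmoothOnH {E : Type*} [NormedAddCommGroup E] [NormedSpace ℝ E] (f : ℍ → E) : Prop :=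
  ContDiffOn ℝ (⊤ : ℕ∞) (fun w : ℂ => f (ofComplex w)) {w : ℂ | 0 < w.im}

/-- `dω = 0`: the derivative of `ω` is a symmetric bilinear map at each point. -/
def ClosedForm (ω : OneForm k) : Prop :=
  ∀ (z : ℍ) (u v : ℂ), fderiv ℝ (fun w : ℂ => ω (ofComplex w)) z u v =
    fderiv ℝ (fun w : ℂ => ω (ofComplex w)) z v u

/-- The exterior derivative of a function. -/
def extD (f : ℍ → V k ℂ) : OneForm k := fun z => fderiv ℝ (fun w : ℂ => f (ofComplex w)) z

variable {k}

lemma isOpenH : IsOpen {w : ℂ | 0 < w.im} := isOpen_lt continuous_const Complex.continuous_im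

lemma convexH : Convex ℝ {w : ℂ | 0 < w.im} := convex_halfSpace_im_gt 0

lemma SmoothOnH.differentiableAt {E : Type*} [NormedAddCommGroup E] [NormedSpace ℝ E] {f : ℍ → E}
    (hf : SmoothOnH f) (z : ℍ) : DifferentiableAt ℝ (fun w : ℂ => f (ofComplex w)) z :=
  (hf.contDiffAt (isOpenH.mem_nhds z.im_pos)).differentiableAt (by simp)

lemma smooth_mobius (g : SL(2, ℝ)) : SmoothOnH fun z : ℍ => ((g • z : ℍ) : ℂ) := by
  intro w hw
  have h := analyticAt_smul (g := mapGL ℝ g) (by simp) ⟨w, hw⟩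
  exact (h.restrictScalars (𝕜 := ℝ)).contDiffAt.contDiffWithinAt

lemma SmoothOnH.comp_mobius {E : Type*} [NormedAddCommGroup E] [NormedSpace ℝ E] {f : ℍ → E}
    (hf : SmoothOnH f) (g : SL(2, ℝ)) : SmoothOnH fun z : ℍ => f (g • z) := by
  have := ContDiffOn.comp hf (smooth_mobius g) (fun w _ => (g • ofComplex w).im_pos)
  simpa [SmoothOnH, Function.comp_def] using this

lemma SmoothOnH.fderiv {E : Type*} [NormedAddCommGroup E] [NormedSpace ℝ E] {f : ℍ → E}
    (hf : SmoothOnH f) : SmoothOnH fun z : ℍ => fderiv ℝ (fun w : ℂ => f (ofComplex w)) z := by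
  have h := ContDiffOn.fderiv_of_isOpen (m := (⊤ : ℕ∞)) hf isOpenH (by simp)
  refine h.congr fun w hw => ?_
  simp [ofComplex_apply_of_im_pos hw]

lemma SmoothOnH.formRep {ω : OneForm k} (hω : SmoothOnH ω) (g : SL(2, ℝ)) :
    SmoothOnH (formRep k g ω) := by
  have h1 := hω.comp_mobius g⁻¹
  have h2 := (smooth_mobius g⁻¹).fderiv
  exact contDiffOn_const.clm_comp (ContDiffOn.clm_comp h1 h2)

lemma SmoothOnH.funRep {f : ℍ → V k ℂ} (hf : SmoothOnH f) (g : SL(2, ℝ)) :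
    SmoothOnH (funRep k g f) :=
  ((realRepL k g).restrictScalars ℝ).contDiff.comp_contDiffOn (hf.comp_mobius g⁻¹)

lemma hasFDerivAt_funRep {F : ℍ → V k ℂ} {ω : OneForm k}
    (hF : ∀ z : ℍ, HasFDerivAt (fun w : ℂ => F (ofComplex w)) (ω z) z) (g : SL(2, ℝ)) (z : ℍ) :
    HasFDerivAt (fun w : ℂ => funRep k g F (ofComplex w)) (formRep k g ω z) z := by
  have h1 := hasFDerivAt_mobius g⁻¹ z
  have h2 := hF (g⁻¹ • z)
  have e : ((g⁻¹ • z : ℍ) : ℂ) = (fun w : ℂ => ((g⁻¹ • ofComplex w : ℍ) : ℂ)) z := by simp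
  rw [e] at h2
  have h3 := ((realRepL k g).restrictScalars ℝ).hasFDerivAt.comp (z : ℂ) (h2.comp (z : ℂ) h1)
  refine h3.congr_of_eventuallyEq (Filter.Eventually.of_forall fun w => ?_)
  simp [funRep, realRepL]

lemma extD_funRep {f : ℍ → V k ℂ} (hf : SmoothOnH f) (g : SL(2, ℝ)) :
    extD k (funRep k g f) = formRep k g (extD k f) :=
  funext fun z => (hasFDerivAt_funRep (fun z => (hf.differentiableAt z).hasFDerivAt) g z).fderiv

lemma closedForm_of_primitive {F : ℍ → V k ℂ} {ω : OneForm k} (hω : SmoothOnH ω)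
    (hF : ∀ z : ℍ, HasFDerivAt (fun w : ℂ => F (ofComplex w)) (ω z) z) : ClosedForm k ω := by
  intro z u v
  refine second_derivative_symmetric_of_eventually (𝕜 := ℝ)
    (f := fun w : ℂ => F (ofComplex w)) ?_ (hω.differentiableAt z).hasFDerivAt u v
  filter_upwards [isOpenH.mem_nhds z.im_pos] with w hw
  simpa [ofComplex_apply_of_im_pos hw] using hF ⟨w, hw⟩

lemma exists_primitive {ω : OneForm k} (hω : SmoothOnH ω) (hc : ClosedForm k ω) :
    ∃ F : ℍ → V k ℂ, ∀ z : ℍ, HasFDerivAt (fun w : ℂ => F (ofComplex w)) (ω z) z := by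
  obtain ⟨F, hF⟩ := convexH.exists_forall_hasFDerivAt_of_fderiv_symmetric isOpenH
    (hω.differentiableOn (by simp)) (fun w hw => by
      simpa [ofComplex_apply_of_im_pos hw] using hc ⟨w, hw⟩)
  refine ⟨fun z => F z, fun z => ?_⟩
  have := hF z z.im_pos
  rw [ofComplex_apply] at this
  refine this.congr_of_eventuallyEq ?_
  filter_upwards [eventuallyEq_coe_comp_ofComplex z.im_pos] with w hw
  exact congrArg F hw

lemma ClosedForm.formRep {ω : OneForm k} (hω : SmoothOnH ω) (hc : ClosedForm k ω)
    (g : SL(2, ℝ)) : ClosedForm k (formRep k g ω) := by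
  obtain ⟨F, hF⟩ := exists_primitive hω hc
  exact closedForm_of_primitive (hω.formRep g) (hasFDerivAt_funRep hF g)

end Forms

section DeRham
variable (k N : ℕ)

def IsInvariantForm (ω : OneForm k) : Prop :=
  ∀ γ ∈ CongruenceSubgroup.Gamma N, formRep k (toReal γ) ω = ω

def IsInvariantFun (f : ℍ → V k ℂ) : Prop :=
  ∀ γ ∈ CongruenceSubgroup.Gamma N, funRep k (toReal γ) f = f

/-- Closed smooth `Γ(N)`-invariant `1`-forms on the upper half-plane with values in `V_k ⊗ ℂ`, that is,
closed `1`-forms on `H / Γ(N)` with values in the local system `V_k ⊗ ℂ`. -/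
def Z1 : Submodule ℂ (OneForm k) where
  carrier := {ω | SmoothOnH ω ∧ ClosedForm k ω ∧ IsInvariantForm k N ω}
  zero_mem' := by
    refine ⟨contDiffOn_const, fun z u v => ?_, fun γ _ => map_zero _⟩
    simp
  add_mem' := by
    rintro ω η ⟨h1, h2, h3⟩ ⟨h1', h2', h3'⟩
    refine ⟨ContDiffOn.add h1 h1', fun z u v => ?_, fun γ hγ => ?_⟩
    · have := ((h1.differentiableAt z).hasFDerivAt.add (h1'.differentiableAt z).hasFDerivAt).fderiv
      change fderiv ℝ ((fun w : ℂ => ω (ofComplex w)) + fun w : ℂ => η (ofComplex w)) z u v =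
        fderiv ℝ ((fun w : ℂ => ω (ofComplex w)) + fun w : ℂ => η (ofComplex w)) z v u
      rw [this]
      simp [h2 z u v, h2' z u v]
    · rw [map_add, h3 γ hγ, h3' γ hγ]
  smul_mem' := by
    rintro c ω ⟨h1, h2, h3⟩
    refine ⟨ContDiffOn.const_smul c h1, fun z u v => ?_, fun γ hγ => ?_⟩
    · have := ((h1.differentiableAt z).hasFDerivAt.const_smul c).fderiv
      change fderiv ℝ (c • fun w : ℂ => ω (ofComplex w)) z u v =
        fderiv ℝ (c • fun w : ℂ => ω (ofComplex w)) z v u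
      rw [this]
      simp [h2 z u v]
    · rw [map_smul, h3 γ hγ]

instance : AddCommGroup (Z1 k N) := Submodule.addCommGroup _

/-- Differentials of smooth `Γ(N)`-invariant functions with values in `V_k ⊗ ℂ`. -/
def B1 : Submodule ℂ (Z1 k N) where
  carrier := {ω | ∃ f : ℍ → V k ℂ, SmoothOnH f ∧ IsInvariantFun k N f ∧ (ω : OneForm k) = extD k f}
  zero_mem' := by
    refine ⟨0, contDiffOn_const, fun γ _ => map_zero _, ?_⟩
    funext z
    simp [extD]
  add_mem' := by
    rintro ω η ⟨f, hf, hi, e⟩ ⟨f', hf', hi', e'⟩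
    refine ⟨f + f', ContDiffOn.add hf hf', fun γ hγ => by rw [map_add, hi γ hγ, hi' γ hγ], ?_⟩
    funext z
    have := ((hf.differentiableAt z).hasFDerivAt.add (hf'.differentiableAt z).hasFDerivAt).fderiv
    change _ = fderiv ℝ ((fun w : ℂ => f (ofComplex w)) + fun w : ℂ => f' (ofComplex w)) z
    rw [this]
    simp [e, e', extD]
  smul_mem' := by
    rintro c ω ⟨f, hf, hi, e⟩
    refine ⟨c • f, ContDiffOn.const_smul c hf, fun γ hγ => by rw [map_smul, hi γ hγ], ?_⟩
    funext z
    have := ((hf.differentiableAt z).hasFDerivAt.const_smul c).fderiv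
    change _ = fderiv ℝ (c • fun w : ℂ => f (ofComplex w)) z
    rw [this]
    simp [e, extD]

/-- `H¹(H / Γ(N), V_k ⊗ ℂ)`, computed by the complex of smooth forms. -/
abbrev H1dR : Type := Z1 k N ⧸ B1 k N

variable {k N}

lemma conj_mem_Gamma (g : SL(2, ℤ)) {γ : SL(2, ℤ)} (hγ : γ ∈ CongruenceSubgroup.Gamma N) :
    g⁻¹ * γ * g ∈ CongruenceSubgroup.Gamma N := by
  simpa using (CongruenceSubgroup.Gamma_normal N).conj_mem γ hγ g⁻¹

lemma formRep_mem_Z1 (g : SL(2, ℤ)) {ω : OneForm k} (hω : ω ∈ Z1 k N) :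
    formRep k (toReal g) ω ∈ Z1 k N := by
  refine ⟨hω.1.formRep _, hω.2.1.formRep hω.1 _, fun γ hγ => ?_⟩
  have h := hω.2.2 _ (conj_mem_Gamma g hγ)
  have e : γ * g = g * (g⁻¹ * γ * g) := by group
  rw [← Module.End.mul_apply, ← map_mul, ← map_mul, e, map_mul, map_mul, Module.End.mul_apply, h]

lemma funRep_invariant (g : SL(2, ℤ)) {f : ℍ → V k ℂ} (hf : IsInvariantFun k N f) :
    IsInvariantFun k N (funRep k (toReal g) f) := by
  intro γ hγ
  have h := hf _ (conj_mem_Gamma g hγ)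
  have e : γ * g = g * (g⁻¹ * γ * g) := by group
  rw [← Module.End.mul_apply, ← map_mul, ← map_mul, e, map_mul, map_mul, Module.End.mul_apply, h]

variable (k N)

/-- `SL(2, ℤ)` acts on closed invariant forms. -/
def Z1Rep : Representation ℂ SL(2, ℤ) (Z1 k N) where
  toFun g := (formRep k (toReal g)).restrict fun _ hω => formRep_mem_Z1 g hω
  map_one' := by ext1 ω; ext1; simp [LinearMap.restrict_apply]
  map_mul' g h := by
    ext1 ω; ext1
    simp only [map_mul]
    rfl

lemma Z1Rep_mem_B1 (g : SL(2, ℤ)) : B1 k N ≤ (B1 k N).comap (Z1Rep k N g) := by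
  rintro ω ⟨f, hf, hi, e⟩
  refine ⟨funRep k (toReal g) f, hf.funRep _, funRep_invariant g hi, ?_⟩
  rw [extD_funRep hf, ← e]
  rfl

/-- `SL(2, ℤ)` acts on the de Rham cohomology. -/
def H1dRRepInt : Representation ℂ SL(2, ℤ) (H1dR k N) where
  toFun g := (B1 k N).mapQ (B1 k N) (Z1Rep k N g) (Z1Rep_mem_B1 k N g)
  map_one' := by
    ext x
    simp
  map_mul' g h := by
    ext x
    simp

lemma H1dRRepInt_Gamma : CongruenceSubgroup.Gamma N ≤ (H1dRRepInt k N).ker := by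
  intro γ hγ
  rw [MonoidHom.mem_ker]
  ext ω
  refine congrArg (Submodule.Quotient.mk (p := B1 k N)) (Subtype.ext ?_)
  exact ω.2.2.2 γ hγ

end DeRham

section Reduction

theorem exists_isCoprime_add_mul {c d N : ℤ} (hc : c ≠ 0)
    (h : IsCoprime d (gcd c N)) : ∃ t : ℤ, IsCoprime c (d + t * N) := by
  have hc' : c.natAbs ≠ 0 := by simpa using hc
  have : NeZero c.natAbs := ⟨hc'⟩
  set m : ℕ := Int.gcd c N with hm
  have hmc : m ∣ c.natAbs := Nat.gcd_dvd_left _ _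
  have hd : IsUnit ((d : ℤ) : ZMod m) := by
    rw [ZMod.coe_int_isUnit_iff_isCoprime]
    exact h.symm
  obtain ⟨u, hu⟩ := ZMod.unitsMap_surjective hmc hd.unit
  obtain ⟨e, he⟩ := ZMod.intCast_surjective (u : ZMod c.natAbs)
  have h1 : IsCoprime ((c.natAbs : ℕ) : ℤ) e := by
    rw [← ZMod.coe_int_isUnit_iff_isCoprime, he]
    exact u.isUnit
  have h2 : ((e : ℤ) : ZMod m) = d := by
    have := congrArg Units.val hu
    rw [ZMod.unitsMap_def] at this
    simp only [Units.coe_map, IsUnit.unit_spec, MonoidHom.coe_coe] at this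
    rw [← he] at this
    simpa using this
  have h3 : (m : ℤ) ∣ e - d := by
    rw [← ZMod.intCast_eq_intCast_iff_dvd_sub]
    exact h2.symm
  obtain ⟨s, hs⟩ := h3
  have hb := Int.gcd_eq_gcd_ab c N
  refine ⟨s * Int.gcdB c N, ?_⟩
  have h4 : IsCoprime c e := by
    rcases Int.natAbs_eq c with hh | hh <;> rw [hh]
    · exact h1
    · exact h1.neg_left
  have : d + s * Int.gcdB c N * N = e + c * (-(s * Int.gcdA c N)) := by
    have : e = d + (c * Int.gcdA c N + N * Int.gcdB c N) * s := by
      rw [← hb]; linarith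
    rw [this]; ring
  rw [this]
  exact h4.add_mul_left_right _

/-- Reduction modulo `N` is surjective on `SL(2)`. -/
theorem reduction_surjective (N : ℕ) :
    Function.Surjective (map (n := Fin 2) (Int.castRingHom (ZMod N))) := by
  intro g
  rcases Nat.eq_zero_or_pos N with rfl | hN
  · refine ⟨g, ?_⟩
    refine Matrix.SpecialLinearGroup.ext _ _ fun i j => ?_
    change ((Int.castRingHom (ZMod 0)) (g.1 i j) : ZMod 0) = g.1 i j
    exact Int.cast_id
  choose l hl using ZMod.intCast_surjective (n := N)
  have hdet : g 0 0 * g 1 1 - g 0 1 * g 1 0 = 1 := by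
    rw [← Matrix.det_fin_two]; exact g.2
  obtain ⟨c, hc0, hc⟩ : ∃ c : ℤ, c ≠ 0 ∧ (c : ZMod N) = g 1 0 := by
    by_cases h : l (g 1 0) = 0
    · refine ⟨N, by positivity, ?_⟩
      rw [← hl (g 1 0), h]; simp
    · exact ⟨_, h, hl _⟩
  set a := l (g 0 0); set b := l (g 0 1); set d := l (g 1 1)
  have ha : (a : ZMod N) = g 0 0 := hl _
  have hb : (b : ZMod N) = g 0 1 := hl _
  have hd : (d : ZMod N) = g 1 1 := hl _
  have key : ((a * d - b * c : ℤ) : ZMod N) = ((1 : ℤ) : ZMod N) := by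
    push_cast; rw [ha, hb, hc, hd, hdet]
  rw [eq_comm, ZMod.intCast_eq_intCast_iff_dvd_sub] at key
  obtain ⟨r, hr⟩ := key
  have hcop : IsCoprime d (gcd c (N : ℤ)) := by
    obtain ⟨c', hc'⟩ := gcd_dvd_left c (N : ℤ)
    obtain ⟨n', hn'⟩ := gcd_dvd_right c (N : ℤ)
    refine ⟨a, -(b * c' + n' * r), ?_⟩
    have e1 : b * (gcd c (N : ℤ) * c') = b * c := by rw [← hc']
    have e2 : gcd c (N : ℤ) * n' * r = N * r := by rw [← hn']
    linear_combination hr - e1 - e2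
  obtain ⟨t, ht⟩ := exists_isCoprime_add_mul hc0 hcop
  obtain ⟨y, x, hxy⟩ := ht
  set d' := d + t * N
  obtain ⟨r', hr'⟩ : ∃ r' : ℤ, a * d' - b * c - 1 = N * r' :=
    ⟨r + a * t, by simp only [d']; linear_combination hr⟩
  refine ⟨⟨!![a - N * r' * x, b + N * r' * y; c, d'], ?_⟩, ?_⟩
  · rw [Matrix.det_fin_two_of]
    linear_combination hr' - (N * r') * hxy
  · refine Matrix.SpecialLinearGroup.ext _ _ fun i j => ?_
    have hN0 : ((N : ℕ) : ZMod N) = 0 := ZMod.natCast_self N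
    fin_cases i <;> fin_cases j
    · change ((a - N * r' * x : ℤ) : ZMod N) = g 0 0
      push_cast; rw [hN0, ha]; ring
    · change ((b + N * r' * y : ℤ) : ZMod N) = g 0 1
      push_cast; rw [hN0, hb]; ring
    · exact hc
    · change ((d + t * N : ℤ) : ZMod N) = g 1 1
      push_cast; rw [hN0, hd]; ring

end Reduction

section GroupCohomology
open CategoryTheory groupCohomology
variable (R : Type) [CommRing R] (k N : ℕ)

/-- `Sym^k (R²)` as a representation of `Γ(N)`. -/
abbrev GammaRep : Rep R (CongruenceSubgroup.Gamma N) :=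
  Rep.of ((symRepInt R k).comp (CongruenceSubgroup.Gamma N).subtype)

/-- Group cohomology `H¹(Γ(N), Sym^k (R²))`. -/
abbrev H1Gamma : Type := groupCohomology.H1 (GammaRep R k N)

instance : (CongruenceSubgroup.Gamma N).Normal := CongruenceSubgroup.Gamma_normal N

/-- `γ ↦ g⁻¹ γ g` on `Γ(N)`. -/
def conjInv (g : SL(2, ℤ)) : CongruenceSubgroup.Gamma N →* CongruenceSubgroup.Gamma N :=
  (MulAut.conjNormal g⁻¹ : MulAut (CongruenceSubgroup.Gamma N)).toMonoidHom

lemma coe_conjInv (g : SL(2, ℤ)) (γ : CongruenceSubgroup.Gamma N) :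
    (conjInv N g γ : SL(2, ℤ)) = g⁻¹ * γ * g := by
  simp [conjInv]

lemma conjInv_mul (g h : SL(2, ℤ)) (γ : CongruenceSubgroup.Gamma N) :
    conjInv N (g * h) γ = conjInv N h (conjInv N g γ) :=
  Subtype.ext (by simp only [coe_conjInv]; group)

/-- `v ↦ g · v` is compatible with `γ ↦ g⁻¹ γ g`. -/
def actCoeff (g : SL(2, ℤ)) :
    Rep.res (conjInv N g) (GammaRep R k N) ⟶ GammaRep R k N :=
  Rep.ofHom
    { symRepInt R k g with
      isIntertwining' := fun γ => by
        change symRepInt R k g ∘ₗ symRepInt R k (conjInv N g γ) =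
          symRepInt R k γ ∘ₗ symRepInt R k g
        rw [← Module.End.mul_eq_comp, ← Module.End.mul_eq_comp, ← map_mul, ← map_mul, coe_conjInv]
        congr 1
        group }

/-- The action of `g` on `H¹(Γ(N), Sym^k (R²))`: on cocycles it is `c ↦ (γ ↦ g · c (g⁻¹ γ g))`. -/
def H1GammaAct (g : SL(2, ℤ)) : H1Gamma R k N →ₗ[R] H1Gamma R k N :=
  (groupCohomology.map (conjInv N g) (actCoeff R k N g) 1).hom

/-- The action of `g` on cocycles. -/
def cocycleAct (g : SL(2, ℤ)) (c : cocycles₁ (GammaRep R k N)) : cocycles₁ (GammaRep R k N) :=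
  mapCocycles₁ (conjInv N g) (actCoeff R k N g) c

lemma cocycleAct_apply (g : SL(2, ℤ)) (c : cocycles₁ (GammaRep R k N))
    (γ : CongruenceSubgroup.Gamma N) :
    cocycleAct R k N g c γ = symRepInt R k g (c (conjInv N g γ)) := rfl

lemma H1GammaAct_π (g : SL(2, ℤ)) (c : cocycles₁ (GammaRep R k N)) :
    H1GammaAct R k N g (H1π _ c) = H1π _ (cocycleAct R k N g c) :=
  H1π_comp_map_apply (conjInv N g) (actCoeff R k N g) c

/-- `SL(2, ℤ)` acts on group cohomology. -/
def H1GammaRepInt : Representation R SL(2, ℤ) (H1Gamma R k N) where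
  toFun g := H1GammaAct R k N g
  map_one' := by
    ext1 x
    induction x using H1_induction_on with | @h c =>
    rw [H1GammaAct_π]
    refine congrArg _ (cocycles₁_ext fun γ => ?_)
    rw [cocycleAct_apply, map_one]
    refine congrArg c (Subtype.ext ?_)
    simp [coe_conjInv]
  map_mul' g h := by
    ext1 x
    induction x using H1_induction_on with | @h c =>
    rw [Module.End.mul_apply, H1GammaAct_π, H1GammaAct_π, H1GammaAct_π]
    refine congrArg _ (cocycles₁_ext fun γ => ?_)
    rw [cocycleAct_apply, cocycleAct_apply, cocycleAct_apply, conjInv_mul, map_mul]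
    rfl

lemma H1GammaRepInt_Gamma : CongruenceSubgroup.Gamma N ≤ (H1GammaRepInt R k N).ker := by
  intro g hg
  rw [MonoidHom.mem_ker]
  ext1 x
  induction x using H1_induction_on with | @h c =>
  change H1GammaAct R k N g (H1π _ c) = H1π _ c
  rw [H1GammaAct_π, H1π_eq_iff]
  refine ⟨c ⟨g, hg⟩, ?_⟩
  funext γ
  have hc := (mem_cocycles₁_iff (c : _ → _)).1 c.2
  have e : conjInv N g γ = (⟨g, hg⟩⁻¹ : CongruenceSubgroup.Gamma N) * (γ * ⟨g, hg⟩) :=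
    Subtype.ext (by simp [coe_conjInv, mul_assoc])
  have h1 := hc ⟨g, hg⟩⁻¹ (γ * ⟨g, hg⟩)
  have h2 := hc γ ⟨g, hg⟩
  have h3 := cocycles₁_map_inv c ⟨g, hg⟩
  have h4 : ∀ v, (GammaRep R k N).ρ ⟨g, hg⟩ ((GammaRep R k N).ρ (⟨g, hg⟩⁻¹) v) = v := fun v =>
    Representation.self_inv_apply _ _ _
  change (GammaRep R k N).ρ γ (c ⟨g, hg⟩) - c ⟨g, hg⟩ = _
  have h5 : cocycleAct R k N g c γ = (GammaRep R k N).ρ ⟨g, hg⟩ (c (conjInv N g γ)) := rfl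
  rw [Pi.sub_apply, h5, e, h1, map_add, h4, h2, h3]
  simp
  abel

end GroupCohomology

section Actions
variable (k N : ℕ)

lemma eq_of_reduction_eq {M : Type} [AddCommGroup M] [Module ℂ M]
    (ρ : Representation ℂ SL(2, ℤ) M) (h : CongruenceSubgroup.Gamma N ≤ ρ.ker) {g g' : SL(2, ℤ)}
    (e : map (Int.castRingHom (ZMod N)) g = map (Int.castRingHom (ZMod N)) g') : ρ g = ρ g' := by
  have h1 : g'⁻¹ * g ∈ CongruenceSubgroup.Gamma N := by
    rw [CongruenceSubgroup.Gamma_mem', map_mul, map_inv, e, inv_mul_cancel]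
  have h2 : ρ (g'⁻¹ * g) = 1 := h h1
  rw [← mul_inv_cancel_left g' g, map_mul, h2, mul_one]

/-- A representation of `SL(2, ℤ)` on which `Γ(N)` acts trivially, viewed as a representation of
`SL(2, ℤ/N)`: an element acts through any of its lifts to `SL(2, ℤ)`. -/
def descend {M : Type} [AddCommGroup M] [Module ℂ M] (ρ : Representation ℂ SL(2, ℤ) M)
    (h : CongruenceSubgroup.Gamma N ≤ ρ.ker) : Representation ℂ SL(2, ZMod N) M where
  toFun g := ρ (Function.surjInv (reduction_surjective N) g)
  map_one' := by
    rw [← map_one ρ]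
    exact eq_of_reduction_eq N ρ h (by rw [Function.surjInv_eq (reduction_surjective N), map_one])
  map_mul' g g' := by
    rw [← map_mul ρ]
    exact eq_of_reduction_eq N ρ h (by simp only [map_mul, Function.surjInv_eq (reduction_surjective N)])

lemma descend_reduction {M : Type} [AddCommGroup M] [Module ℂ M] (ρ : Representation ℂ SL(2, ℤ) M)
    (h : CongruenceSubgroup.Gamma N ≤ ρ.ker) (g : SL(2, ℤ)) :
    descend N ρ h (map (Int.castRingHom (ZMod N)) g) = ρ g :=
  eq_of_reduction_eq N ρ h (Function.surjInv_eq (reduction_surjective N) _)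

/-- The action of `SL(2, ℤ/N)` on `H¹(H / Γ(N), V_k ⊗ ℂ)`. -/
def H1dRRep : Representation ℂ SL(2, ZMod N) (H1dR k N) :=
  descend N (H1dRRepInt k N) (H1dRRepInt_Gamma k N)

/-- The action of `SL(2, ℤ/N)` on `H¹(Γ(N), V_k ⊗ ℂ)`. -/
def H1GammaRep : Representation ℂ SL(2, ZMod N) (H1Gamma ℂ k N) :=
  descend N (H1GammaRepInt ℂ k N) (H1GammaRepInt_Gamma ℂ k N)

end Actions

section Periods
open groupCohomology
variable (k N : ℕ)

/-- `∫_a^b ω`, along the straight segment from `a` to `b`. -/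
def formIntegral (ω : OneForm k) (a b : ℍ) : V k ℂ :=
  curveIntegral (fun w : ℂ => ω (ofComplex w)) (Path.segment (a : ℂ) (b : ℂ))

/-- The function `γ ↦ ∫_{z₀}^{γ z₀} ω` on `Γ(N)`. -/
def periodCochain (z₀ : ℍ) (ω : OneForm k) : CongruenceSubgroup.Gamma N → V k ℂ :=
  fun γ => formIntegral k ω z₀ ((γ : SL(2, ℤ)) • z₀)

/-- The inclusion of `V_k` into `V_k ⊗ ℂ`. -/
def ratToComplex (v : V k ℚ) : V k ℂ := fun i => (v i : ℂ)

/-- A Čech `1`-cocycle on `H / Γ(N)` with values in the rational local system `V_k`. Open subsets of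
`H / Γ(N)` are given by their preimages, the `Γ(N)`-stable open subsets of `H`; a section of the
local system over such a subset is a locally constant `Γ(N)`-equivariant function to `V_k`. -/
structure CechCocycle where
  U : ℍ → Set ℍ
  isOpen_U : ∀ x, IsOpen (U x)
  mem_U : ∀ x, x ∈ U x
  smul_mem_U : ∀ x, ∀ γ ∈ CongruenceSubgroup.Gamma N, ∀ z ∈ U x, γ • z ∈ U x
  q : ℍ → ℍ → ℍ → V k ℚ
  locallyConst : ∀ x y, ∀ z ∈ U x ∩ U y, ∀ᶠ w in 𝓝 z, q x y w = q x y z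
  equivariant : ∀ x y, ∀ γ ∈ CongruenceSubgroup.Gamma N, ∀ z ∈ U x ∩ U y,
    q x y (γ • z) = symRepInt ℚ k γ (q x y z)
  cocycle : ∀ x y t, ∀ z ∈ U x ∩ U y ∩ U t, q x y z + q y t z = q x t z

/-- The closed form `ω` and the Čech cocycle `c` give the same class in `H¹(H / Γ(N), V_k ⊗ ℂ)`: there
are equivariant primitives `f x` of `ω` on the sets of the cover whose differences form `c`. -/
def CechCocycle.Represents {k N : ℕ} (c : CechCocycle k N) (ω : OneForm k) : Prop :=
  ∃ f : ℍ → ℍ → V k ℂ,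
    (∀ x, ∀ z ∈ c.U x, HasFDerivAt (fun w : ℂ => f x (ofComplex w)) (ω z) z) ∧
    (∀ x, ∀ γ ∈ CongruenceSubgroup.Gamma N, ∀ z ∈ c.U x,
      f x (γ • z) = symRepInt ℂ k γ (f x z)) ∧
    ∀ x y, ∀ z ∈ c.U x ∩ c.U y, f y z - f x z = ratToComplex k (c.q x y z)

/-- The rational structure of `H¹(H / Γ(N), V_k ⊗ ℂ)`: the image of `H¹(H / Γ(N), V_k)`. -/
def rationalDeRham : Set (H1dR k N) :=
  {x | ∃ (ω : Z1 k N) (c : CechCocycle k N),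
    x = Submodule.Quotient.mk ω ∧ c.Represents (ω : OneForm k)}

/-- The rational structure of `H¹(Γ(N), V_k ⊗ ℂ)`: the image of `H¹(Γ(N), V_k)`. -/
def rationalGroup : Set (H1Gamma ℂ k N) :=
  {x | ∃ (c : cocycles₁ (GammaRep ℚ k N)) (c' : cocycles₁ (GammaRep ℂ k N)),
    (∀ γ, c' γ = ratToComplex k (c γ)) ∧ x = H1π (GammaRep ℂ k N) c'}

end Periods
end SymCoh

end

/-! The half-plane is convex, so a closed form `ω` has a primitive `F`, unique up to a constant. If
`ω` is invariant, `γ · F` is again a primitive, so `F (γ z) - γ · F z` does not depend on `z`. This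
`monodromy` is a cocycle in `γ`. By the fundamental theorem of calculus the period `F (γ z₀) - F z₀`
differs from it by the coboundary of `F z₀` (`H1π_periodCochain`), so every statement about periods
becomes one about primitives.

Injectivity: if the periods form a coboundary, some primitive is equivariant
(`mem_B1_of_periodCochain_mem`). Surjectivity: averaging a cocycle against the `SL(2, ℤ)`-translates
of a bump function gives a smooth `F` with that cocycle as monodromy, and `dF` is the required form
(`exists_smooth_of_cocycle`). Equivariance: `g · F` is a primitive of `g · ω`.

Rationality: local equivariant primitives with rational differences define, modulo rational vectors,
a locally constant comparison with `F`. The half-plane is connected, so this is a single constant,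
whose coboundary makes the monodromy rational (`CechCocycle.Represents.mem_rationalGroup`).
Conversely, `Γ(N)` acts freely for `N ≥ 3`. Over evenly covered sets, subtracting from `F` the value
of the cocycle at the sheet index gives equivariant local primitives with rational differences
(`cechOfCocycle_represents`). -/

noncomputable section
namespace SymCoh

/-! ### Primitives of closed forms, their monodromy and their periods. -/

section Primitives
variable {k N : ℕ}

/-- `F` is a primitive of the `1`-form `ω`. -/
def IsPrimitive (ω : OneForm k) (F : ℍ → V k ℂ) : Prop :=
  ∀ z : ℍ, HasFDerivAt (fun w : ℂ => F (ofComplex w)) (ω z) z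

lemma IsPrimitive.hasFDerivAt {ω : OneForm k} {F : ℍ → V k ℂ} (hF : IsPrimitive ω F) {w : ℂ}
    (hw : 0 < w.im) : HasFDerivAt (fun w : ℂ => F (ofComplex w)) (ω (ofComplex w)) w := by
  simpa [ofComplex_apply_of_im_pos hw] using hF ⟨w, hw⟩

lemma IsPrimitive.extD_eq {ω : OneForm k} {F : ℍ → V k ℂ} (hF : IsPrimitive ω F) :
    extD k F = ω :=
  funext fun z => (hF z).fderiv

lemma smoothOnH_extD {F : ℍ → V k ℂ} (hF : SmoothOnH F) : SmoothOnH (extD k F) := hF.fderiv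

lemma SmoothOnH.isPrimitive_extD {F : ℍ → V k ℂ} (hF : SmoothOnH F) : IsPrimitive (extD k F) F :=
  fun z => (hF.differentiableAt z).hasFDerivAt

/-- The derivative of `F` is the smooth form `ω`. Needed because `B1` asks for smooth functions,
while a primitive is only given as differentiable. -/
lemma IsPrimitive.smooth {ω : OneForm k} {F : ℍ → V k ℂ} (hω : SmoothOnH ω)
    (hF : IsPrimitive ω F) : SmoothOnH F := by
  refine (contDiffOn_infty_iff_fderiv_of_isOpen isOpenH).2
    ⟨fun w hw => (hF.hasFDerivAt hw).differentiableAt.differentiableWithinAt, ?_⟩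
  exact ContDiffOn.congr hω fun w hw => (hF.hasFDerivAt hw).fderiv

lemma IsPrimitive.add_const {ω : OneForm k} {F : ℍ → V k ℂ} (hF : IsPrimitive ω F) (v : V k ℂ) :
    IsPrimitive ω fun z => F z + v :=
  fun z => (hF z).add_const v

lemma IsPrimitive.sub_eq_sub {ω : OneForm k} {F G : ℍ → V k ℂ} (hF : IsPrimitive ω F)
    (hG : IsPrimitive ω G) (z z' : ℍ) : F z - G z = F z' - G z' := by
  have h := isOpenH.is_const_of_fderiv_eq_zero (𝕜 := ℝ)
    (f := fun w : ℂ => F (ofComplex w) - G (ofComplex w)) convexH.isPreconnected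
    (fun w hw => ((hF.hasFDerivAt hw).sub (hG.hasFDerivAt hw)).differentiableAt.differentiableWithinAt)
    (fun w hw => by
      simpa using ((hF.hasFDerivAt hw).fun_sub (hG.hasFDerivAt hw)).fderiv) z.im_pos z'.im_pos
  simpa using h

/-- The fundamental theorem of calculus for curve integrals of exact forms. -/
lemma IsPrimitive.curveIntegral_eq_sub {ω : OneForm k} {F : ℍ → V k ℂ} (hω : SmoothOnH ω)
    (hF : IsPrimitive ω F) {a b : ℍ} (p : Path (a : ℂ) (b : ℂ)) (hp : ∀ t, 0 < (p t).im)
    (hd : ContDiffOn ℝ 1 p.extend (Set.Icc 0 1)) :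
    curveIntegral (fun w : ℂ => ω (ofComplex w)) p = F b - F a := by
  have hpos : ∀ t, 0 < (p.extend t).im := fun t => hp _
  have hint := ContinuousOn.curveIntegrable_of_contDiffOn (γ := p) (s := {w : ℂ | 0 < w.im})
    hω.continuousOn hd hp
  have hderiv : ∀ t ∈ Set.Icc (0 : ℝ) 1,
      HasDerivWithinAt (fun t => F (ofComplex (p.extend t)))
        (curveIntegralFun (fun w : ℂ => ω (ofComplex w)) p t) (Set.Icc 0 1) t := by
    intro t ht
    rw [curveIntegralFun_def]
    exact (hF.hasFDerivAt (hpos t)).comp_hasDerivWithinAt t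
      ((hd.differentiableOn (by simp)) t ht).hasDerivWithinAt
  rw [curveIntegral_def, intervalIntegral.integral_eq_sub_of_hasDerivAt_of_le zero_le_one
    (fun t ht => (hderiv t ht).continuousWithinAt)
    (fun t ht => (hderiv t (Set.Ioo_subset_Icc_self ht)).hasDerivAt (Icc_mem_nhds ht.1 ht.2)) hint]
  simp

lemma IsPrimitive.formIntegral_eq_sub {ω : OneForm k} {F : ℍ → V k ℂ} (hω : SmoothOnH ω)
    (hF : IsPrimitive ω F) (a b : ℍ) : formIntegral k ω a b = F b - F a := by
  refine hF.curveIntegral_eq_sub hω _ (fun t => ?_) ?_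
  · have h := convexH.segment_subset a.im_pos b.im_pos
    refine h ?_
    rw [segment_eq_image_lineMap]
    exact ⟨t, t.2, rfl⟩
  · refine ContDiffOn.congr (f := fun t : ℝ => AffineMap.lineMap (a : ℂ) (b : ℂ) t) ?_
      (Path.eqOn_extend_segment _ _)
    simp only [AffineMap.lineMap_apply_module]
    fun_prop

/-- The failure of equivariance of `F` under `γ`, measured at `z`. -/
def monodromy (F : ℍ → V k ℂ) (z : ℍ) (γ : CongruenceSubgroup.Gamma N) : V k ℂ :=
  F ((γ : SL(2, ℤ)) • z) - symRepInt ℂ k γ (F z)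

lemma funRep_toReal_apply (γ : SL(2, ℤ)) (F : ℍ → V k ℂ) (z : ℍ) :
    funRep k (toReal γ) F z = symRepInt ℂ k γ (F (γ⁻¹ • z)) := by
  rw [← realRep_toReal, ← toReal_smul, map_inv]
  rfl

/-- By invariance `γ · F` is also a primitive of `ω`, so `F - γ · F` is constant; the monodromy at
`z` is its value at `γ z`. -/
lemma IsPrimitive.monodromy_eq {ω : OneForm k} {F : ℍ → V k ℂ} (hi : IsInvariantForm k N ω)
    (hF : IsPrimitive ω F) (z z' : ℍ) : monodromy (N := N) F z = monodromy F z' := by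
  funext γ
  have h : IsPrimitive ω (funRep k (toReal γ) F) := by
    have := hasFDerivAt_funRep hF (toReal γ)
    rwa [hi γ γ.2] at this
  simpa [monodromy, funRep_toReal_apply] using
    hF.sub_eq_sub h ((γ : SL(2, ℤ)) • z) ((γ : SL(2, ℤ)) • z')

lemma IsPrimitive.apply_smul {ω : OneForm k} {F : ℍ → V k ℂ} (hi : IsInvariantForm k N ω)
    (hF : IsPrimitive ω F) (z₀ : ℍ) (γ : CongruenceSubgroup.Gamma N) (z : ℍ) :
    F ((γ : SL(2, ℤ)) • z) = symRepInt ℂ k γ (F z) + monodromy F z₀ γ := by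
  rw [hF.monodromy_eq hi z₀ z]
  simp [monodromy]

lemma isInvariantFun_iff {f : ℍ → V k ℂ} : IsInvariantFun k N f ↔
    ∀ (γ : CongruenceSubgroup.Gamma N) (z : ℍ),
      f ((γ : SL(2, ℤ)) • z) = symRepInt ℂ k γ (f z) := by
  refine ⟨fun h γ z => ?_, fun h γ hγ => funext fun z => ?_⟩
  · conv_lhs => rw [← h γ γ.2, funRep_toReal_apply, inv_smul_smul]
  · rw [funRep_toReal_apply, ← h ⟨γ, hγ⟩, smul_inv_smul]

/-- The functions `F` and `γ · F` differ by the constant `c γ`, hence have the same differential. -/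
lemma isInvariantForm_of_monodromy {F : ℍ → V k ℂ} (hF : SmoothOnH F)
    (c : CongruenceSubgroup.Gamma N → V k ℂ)
    (hc : ∀ (γ : CongruenceSubgroup.Gamma N) (z : ℍ),
      F ((γ : SL(2, ℤ)) • z) = symRepInt ℂ k γ (F z) + c γ) : IsInvariantForm k N (extD k F) := by
  intro γ hγ
  rw [← extD_funRep hF]
  have h : F = fun z => funRep k (toReal γ) F z + c ⟨γ, hγ⟩ := funext fun z => by
    rw [funRep_toReal_apply, ← hc ⟨γ, hγ⟩, smul_inv_smul]
  conv_rhs => rw [h]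
  exact ((hF.funRep (toReal γ)).isPrimitive_extD.add_const _).extD_eq.symm

lemma extD_mem_Z1 {F : ℍ → V k ℂ} (hF : SmoothOnH F) (c : CongruenceSubgroup.Gamma N → V k ℂ)
    (hc : ∀ (γ : CongruenceSubgroup.Gamma N) (z : ℍ),
      F ((γ : SL(2, ℤ)) • z) = symRepInt ℂ k γ (F z) + c γ) : extD k F ∈ Z1 k N :=
  ⟨smoothOnH_extD hF, closedForm_of_primitive (smoothOnH_extD hF) hF.isPrimitive_extD,
    isInvariantForm_of_monodromy hF c hc⟩

open groupCohomology

lemma IsPrimitive.monodromy_mem {ω : OneForm k} {F : ℍ → V k ℂ} (hi : IsInvariantForm k N ω)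
    (hF : IsPrimitive ω F) (z : ℍ) : monodromy F z ∈ cocycles₁ (GammaRep ℂ k N) := by
  rw [mem_cocycles₁_iff]
  intro γ δ
  change monodromy F z (γ * δ) = symRepInt ℂ k γ (monodromy F z δ) + monodromy F z γ
  -- The monodromy of `γ` is the same at `δ z` as at `z`; this independence is what yields the
  -- cocycle relation.
  have h1 := hF.apply_smul hi z γ ((δ : SL(2, ℤ)) • z)
  have h2 := hF.apply_smul hi z δ z
  rw [h2, map_add] at h1
  simp only [monodromy, Subgroup.coe_mul, mul_smul] at h1 ⊢
  rw [h1, map_mul, Module.End.mul_apply]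
  abel

lemma IsPrimitive.periodCochain_eq {ω : OneForm k} {F : ℍ → V k ℂ} (hω : SmoothOnH ω)
    (hF : IsPrimitive ω F) (z₀ : ℍ) (γ : CongruenceSubgroup.Gamma N) :
    periodCochain k N z₀ ω γ =
      monodromy F z₀ γ + (symRepInt ℂ k γ (F z₀) - F z₀) := by
  rw [periodCochain, hF.formIntegral_eq_sub hω, monodromy]
  abel

lemma mem_coboundaries₁_iff {c : CongruenceSubgroup.Gamma N → V k ℂ} :
    c ∈ coboundaries₁ (GammaRep ℂ k N) ↔ ∃ v : V k ℂ, ∀ γ, c γ = symRepInt ℂ k γ v - v := by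
  refine ⟨?_, ?_⟩
  · rintro ⟨v, rfl⟩
    exact ⟨v, fun γ => rfl⟩
  · rintro ⟨v, hv⟩
    exact ⟨v, funext fun γ => (hv γ).symm⟩

lemma periodCochain_mem {ω : OneForm k} (hω : ω ∈ Z1 k N) (z₀ : ℍ) :
    periodCochain k N z₀ ω ∈ cocycles₁ (GammaRep ℂ k N) := by
  obtain ⟨F, hF⟩ := exists_primitive hω.1 hω.2.1
  have h : periodCochain k N z₀ ω =
      monodromy F z₀ + fun γ : CongruenceSubgroup.Gamma N => symRepInt ℂ k γ (F z₀) - F z₀ :=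
    funext fun γ => IsPrimitive.periodCochain_eq hω.1 hF z₀ γ
  rw [h]
  exact Submodule.add_mem _ (IsPrimitive.monodromy_mem hω.2.2 hF z₀)
    (coboundaries₁_le_cocycles₁ _ (mem_coboundaries₁_iff.2 ⟨F z₀, fun _ => rfl⟩))

lemma H1π_periodCochain {ω : OneForm k} (hω : ω ∈ Z1 k N) {F : ℍ → V k ℂ} (hF : IsPrimitive ω F)
    (z₀ : ℍ) : H1π (GammaRep ℂ k N) ⟨periodCochain k N z₀ ω, periodCochain_mem hω z₀⟩ =
      H1π (GammaRep ℂ k N) ⟨monodromy F z₀, hF.monodromy_mem hω.2.2 z₀⟩ := by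
  rw [H1π_eq_iff]
  refine mem_coboundaries₁_iff.2 ⟨F z₀, fun γ => ?_⟩
  change periodCochain k N z₀ ω γ - monodromy F z₀ γ = _
  rw [hF.periodCochain_eq hω.1, add_sub_cancel_left]

lemma periodCochain_extD_mem {f : ℍ → V k ℂ} (hf : SmoothOnH f) (hi : IsInvariantFun k N f)
    (z₀ : ℍ) : periodCochain k N z₀ (extD k f) ∈ coboundaries₁ (GammaRep ℂ k N) := by
  refine mem_coboundaries₁_iff.2 ⟨f z₀, fun γ => ?_⟩
  rw [hf.isPrimitive_extD.periodCochain_eq (smoothOnH_extD hf), monodromy, isInvariantFun_iff.1 hi]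
  simp

lemma mem_B1_of_periodCochain_mem {ω : Z1 k N} {z₀ : ℍ}
    (h : periodCochain k N z₀ ω ∈ coboundaries₁ (GammaRep ℂ k N)) : ω ∈ B1 k N := by
  obtain ⟨F, hF⟩ := exists_primitive ω.2.1 ω.2.2.1
  obtain ⟨v, hv⟩ := mem_coboundaries₁_iff.1 h
  -- This is the primitive with value `v` at `z₀`: for it the hypothesis reads `G (γ z₀) = γ · G
  -- z₀`, and vanishing monodromy at `z₀` means equivariance everywhere.
  have hG := IsPrimitive.add_const hF (v - F z₀)
  refine ⟨_, hG.smooth ω.2.1, isInvariantFun_iff.2 fun γ z => ?_, hG.extD_eq.symm⟩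
  have h1 := hv γ
  rw [IsPrimitive.periodCochain_eq ω.2.1 hF] at h1
  rw [IsPrimitive.apply_smul ω.2.2.2 hF z₀, map_add, map_sub, add_assoc, eq_sub_of_add_eq h1]
  abel

variable (k N) in
/-- The map `ω ↦ S_ω` from closed invariant forms to cocycles. -/
def periodMap (z₀ : ℍ) : Z1 k N →ₗ[ℂ] cocycles₁ (GammaRep ℂ k N) where
  toFun ω := ⟨periodCochain k N z₀ ω, periodCochain_mem ω.2 z₀⟩
  map_add' ω η := by
    -- Linearity of the integral is read off from primitives, which avoids integrability conditions.
    obtain ⟨F, hF⟩ := exists_primitive ω.2.1 ω.2.2.1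
    obtain ⟨G, hG⟩ := exists_primitive η.2.1 η.2.2.1
    have hFG : IsPrimitive ((ω + η : Z1 k N) : OneForm k) (F + G) := fun z => (hF z).add (hG z)
    refine cocycles₁_ext fun γ => ?_
    change formIntegral k _ _ _ = formIntegral k _ _ _ + formIntegral k _ _ _
    rw [hFG.formIntegral_eq_sub (ω + η).2.1, IsPrimitive.formIntegral_eq_sub ω.2.1 hF,
      IsPrimitive.formIntegral_eq_sub η.2.1 hG]
    simp only [Pi.add_apply]
    abel
  map_smul' c ω := by
    obtain ⟨F, hF⟩ := exists_primitive ω.2.1 ω.2.2.1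
    have hcF : IsPrimitive ((c • ω : Z1 k N) : OneForm k) (c • F) := fun z => (hF z).const_smul c
    refine cocycles₁_ext fun γ => ?_
    change formIntegral k _ _ _ = c • formIntegral k _ _ _
    rw [hcF.formIntegral_eq_sub (c • ω).2.1, IsPrimitive.formIntegral_eq_sub ω.2.1 hF, smul_sub]
    rfl

end Primitives
-- Proper discontinuity, freeness for `N ≥ 3`, and Siegel sets.
section ProperlyDiscontinuous

instance : ContinuousConstSMul SL(2, ℤ) ℍ where
  continuous_const_smul γ := by
    simp only [← toReal_smul]
    exact continuous_const_smul _

instance : ProperlyDiscontinuousSMul SL(2, ℤ) ℍ where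
  finite_disjoint_inter_image {K L} hK hL := by
    have h := ProperlyDiscontinuousSMul.finite_disjoint_inter_image (Γ := 𝒮ℒ) hK hL
    let f : SL(2, ℤ) → 𝒮ℒ := fun γ => ⟨mapGL ℝ γ, γ, rfl⟩
    have hf : Function.Injective f := fun γ δ e => mapGL_injective (congrArg Subtype.val e)
    exact (Set.Finite.preimage hf.injOn h).subset fun _ hγ => hγ

/-- An element of `SL(2, ℤ)` fixing a point of the upper half-plane has trace in `{-1, 0, 1}`, unless
it is scalar. -/
lemma eq_scalar_or_trace_sq_lt {γ : SL(2, ℤ)} {z : ℍ} (h : γ • z = z) :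
    (γ 1 0 = 0 ∧ γ 0 1 = 0 ∧ γ 0 0 = γ 1 1) ∨ (γ 0 0 + γ 1 1) ^ 2 < 4 := by
  have hz := z.im_pos
  have hdet : γ 0 0 * γ 1 1 - γ 0 1 * γ 1 0 = 1 := by
    rw [← Matrix.det_fin_two]; exact γ.2
  have hne : ((γ 1 0 : ℝ) : ℂ) * (z : ℂ) + ((γ 1 1 : ℝ) : ℂ) ≠ 0 := by
    have := denom_ne_zero (mapGL ℝ γ) z
    simpa [denom] using this
  have e : (z : ℂ) * (((γ 1 0 : ℝ) : ℂ) * (z : ℂ) + ((γ 1 1 : ℝ) : ℂ)) =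
      ((γ 0 0 : ℝ) : ℂ) * (z : ℂ) + ((γ 0 1 : ℝ) : ℂ) := by
    rw [← div_eq_iff_mul_eq hne]
    conv_rhs => rw [← h]
    rw [coe_specialLinearGroup_apply]
    simp
  have hre := congrArg Complex.re e
  have him := congrArg Complex.im e
  simp only [Complex.add_re, Complex.add_im, Complex.mul_re, Complex.mul_im, Complex.ofReal_re,
    Complex.ofReal_im, coe_re, coe_im, zero_mul, add_zero, sub_zero] at hre him
  -- For `γ = (a b; c d)` the fixed-point equation is `c z² + (d - a) z - b = 0`, so `a - d = 2 c Re
  -- z` and `b = -c |z|²`. With `ad - bc = 1` these give `(a + d)² = 4 - 4 (c Im z)²`.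
  have h1 : (γ 0 0 : ℝ) - γ 1 1 = 2 * γ 1 0 * z.re := by
    refine mul_right_cancel₀ hz.ne' ?_
    linear_combination -him
  have h2 : (γ 0 1 : ℝ) = - γ 1 0 * (z.re ^ 2 + z.im ^ 2) := by
    linear_combination -hre - z.re * h1
  by_cases hc : γ 1 0 = 0
  · left
    refine ⟨hc, ?_, ?_⟩
    · rw [hc] at h2
      exact_mod_cast (by simpa using h2 : (γ 0 1 : ℝ) = 0)
    · rw [hc] at h1
      have : (γ 0 0 : ℝ) = γ 1 1 := by
        rw [← sub_eq_zero, h1]; simp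
      exact_mod_cast this
  · right
    have hdet' : (γ 0 0 * γ 1 1 - γ 0 1 * γ 1 0 : ℝ) = 1 := by exact_mod_cast hdet
    have hc' : (γ 1 0 : ℝ) ≠ 0 := by exact_mod_cast hc
    have h3 : ((γ 0 0 : ℝ) + γ 1 1) ^ 2 = 4 - 4 * (γ 1 0 * z.im) ^ 2 := by
      linear_combination 4 * hdet' + (γ 0 0 - γ 1 1 + 2 * γ 1 0 * z.re : ℝ) * h1 +
        4 * (γ 1 0 : ℝ) * h2
    have h4 : 0 < ((γ 1 0 : ℝ) * z.im) ^ 2 := by positivity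
    have : ((γ 0 0 : ℝ) + γ 1 1) ^ 2 < 4 := by linarith
    exact_mod_cast this

/-- `Γ(N)` acts freely on the upper half-plane for `N ≥ 3`. -/
lemma eq_one_of_smul_eq {N : ℕ} (hN : 3 ≤ N) {γ : SL(2, ℤ)}
    (hγ : γ ∈ CongruenceSubgroup.Gamma N) {z : ℍ} (h : γ • z = z) : γ = 1 := by
  rw [CongruenceSubgroup.Gamma_mem] at hγ
  have hdet : γ 0 0 * γ 1 1 - γ 0 1 * γ 1 0 = 1 := by
    rw [← Matrix.det_fin_two]; exact γ.2
  have hN' : (3 : ℤ) ≤ N := by exact_mod_cast hN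
  obtain ⟨a, ha⟩ : (N : ℤ) ∣ γ 0 0 - 1 := by
    rw [← ZMod.intCast_eq_intCast_iff_dvd_sub]; simp [hγ.1]
  obtain ⟨b, hb⟩ : (N : ℤ) ∣ γ 0 1 := by
    rw [← ZMod.intCast_zmod_eq_zero_iff_dvd]; simp [hγ.2.1]
  obtain ⟨c, hc⟩ : (N : ℤ) ∣ γ 1 0 := by
    rw [← ZMod.intCast_zmod_eq_zero_iff_dvd]; simp [hγ.2.2.1]
  obtain ⟨d, hd⟩ : (N : ℤ) ∣ γ 1 1 - 1 := by
    rw [← ZMod.intCast_eq_intCast_iff_dvd_sub]; simp [hγ.2.2.2]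
  -- The determinant forces the trace to be `2` modulo `N²`, not only modulo `N`. As `N² ≥ 9`, a
  -- trace in `{-1, 0, 1}` is impossible; among scalar matrices, `-1` is excluded because `N` does
  -- not divide `2`.
  have h0 : γ 0 0 + γ 1 1 - 2 = N ^ 2 * (b * c - a * d) := by
    have ha' : γ 0 0 = N * a + 1 := by linarith
    have hd' : γ 1 1 = N * d + 1 := by linarith
    rw [ha', hd', hb, hc] at hdet
    rw [ha', hd']
    linear_combination hdet
  rcases eq_scalar_or_trace_sq_lt h with ⟨h1, h2, h3⟩ | h1
  · have h4 : γ 1 1 = 1 := by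
      rw [h1, h3] at hdet
      have h5 : (γ 1 1 - 1) * (γ 1 1 + 1) = 0 := by linear_combination hdet
      rcases mul_eq_zero.1 h5 with h6 | h6
      · linarith
      · exfalso
        have h7 : (N : ℤ) * d = -2 := by rw [← hd]; linarith
        have h8 : (N : ℤ) ∣ 2 := ⟨-d, by linarith⟩
        have := Int.le_of_dvd (by norm_num) h8
        omega
    refine Matrix.SpecialLinearGroup.ext _ _ fun i j => ?_
    fin_cases i <;> fin_cases j
    · exact h3.trans h4
    · exact h2
    · exact h1
    · exact h4
  · exfalso
    set m := b * c - a * d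
    set t := γ 0 0 + γ 1 1
    have h5 : -2 < t ∧ t < 2 := by constructor <;> nlinarith
    have h6 : (N : ℤ) ^ 2 * m < 0 := by linarith
    have h7 : m ≤ -1 := by
      by_contra hm
      have : 0 ≤ (N : ℤ) ^ 2 * m := mul_nonneg (sq_nonneg _) (by omega)
      linarith
    nlinarith

/-- By proper discontinuity only elements fixing `z` can return points of a small neighbourhood to
it, and `Γ(N)` acts freely. -/
lemma exists_nhds_smul_mem {N : ℕ} (hN : 3 ≤ N) (z : ℍ) : ∃ W : Set ℍ, IsOpen W ∧ z ∈ W ∧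
    ∀ γ ∈ CongruenceSubgroup.Gamma N, ∀ w ∈ W, γ • w ∈ W → γ = 1 := by
  obtain ⟨U, hU, h⟩ :=
    ProperlyDiscontinuousSMul.exists_nhds_image_smul_eq_self SL(2, ℤ) z
  obtain ⟨W, hWU, hW, hz⟩ := mem_nhds_iff.1 hU
  exact ⟨W, hW, hz, fun γ hγ w hw hw' =>
    eq_one_of_smul_eq hN hγ (h γ ⟨_, ⟨w, hWU hw, rfl⟩, hWU hw'⟩)⟩

/-- Here `|cz + d|²` is at least `1` if `c = 0` and at least `(Im z)²` otherwise. The bound is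
uniform in `g`, so the translates of a compact set meet a Siegel set only inside a compact
rectangle. -/
lemma im_smul_le_max (g : SL(2, ℤ)) (z : ℍ) : (g • z).im ≤ max z.im z.im⁻¹ := by
  have hz := z.im_pos
  have hdet : g 0 0 * g 1 1 - g 0 1 * g 1 0 = 1 := by
    rw [← Matrix.det_fin_two]; exact g.2
  have hn : Complex.normSq ((g 1 0 : ℂ) * z + g 1 1) =
      (g 1 0 * z.re + g 1 1) ^ 2 + (g 1 0 * z.im) ^ 2 := by
    rw [Complex.normSq_apply]
    simp
    ring
  rw [ModularGroup.im_smul_eq_div_normSq, ModularGroup.denom_apply, hn]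
  by_cases hc : g 1 0 = 0
  · refine le_max_of_le_left ?_
    rw [hc] at hdet
    have hd : g 1 1 ≠ 0 := by
      intro h; rw [h] at hdet; simp at hdet
    have h1 : (1 : ℝ) ≤ (g 1 1 : ℝ) ^ 2 := by
      have : (1 : ℤ) ≤ (g 1 1) ^ 2 := by have := sq_pos_of_ne_zero hd; omega
      exact_mod_cast this
    rw [hc]
    simpa using div_le_self hz.le h1
  · refine le_max_of_le_right ?_
    have h1 : (1 : ℝ) ≤ (g 1 0 : ℝ) ^ 2 := by
      have : (1 : ℤ) ≤ (g 1 0) ^ 2 := by have := sq_pos_of_ne_zero hc; omega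
      exact_mod_cast this
    have h2 : z.im ^ 2 ≤ (g 1 0 * z.re + g 1 1) ^ 2 + (g 1 0 * z.im) ^ 2 := by
      nlinarith [sq_nonneg (g 1 0 * z.re + g 1 1), sq_nonneg z.im]
    calc z.im / _ ≤ z.im / z.im ^ 2 := by gcongr
      _ = z.im⁻¹ := by field_simp

lemma isCompact_rectangle (a b c d : ℝ) (hc : 0 < c) :
    IsCompact {z : ℍ | z.re ∈ Set.Icc a b ∧ z.im ∈ Set.Icc c d} := by
  rw [isEmbedding_coe.isCompact_iff]
  have h : IsCompact (Set.Icc a b ×ℂ Set.Icc c d) := isCompact_Icc.reProdIm isCompact_Icc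
  convert! h using 1
  ext w
  refine ⟨?_, fun hw => ⟨⟨w, hc.trans_le hw.2.1⟩, hw, rfl⟩⟩
  rintro ⟨z, hz, rfl⟩
  exact hz

/-- Only finitely many translates of a Siegel set meet a given compact set. -/
lemma finite_smul_mem_siegel {K : Set ℍ} (hK : IsCompact K) :
    {g : SL(2, ℤ) | ∃ z ∈ K, (g • z).re ∈ Set.Icc (-1 : ℝ) 1 ∧ 1 / 2 ≤ (g • z).im}.Finite := by
  have hcont : ContinuousOn (fun z : ℍ => max z.im z.im⁻¹) K := by
    refine Continuous.continuousOn ?_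
    exact continuous_im.max (continuous_im.inv₀ fun z => z.im_pos.ne')
  obtain ⟨B, hB⟩ := hK.bddAbove_image hcont
  refine (ProperlyDiscontinuousSMul.finite_disjoint_inter_image (Γ := SL(2, ℤ)) hK
    (isCompact_rectangle (-1) 1 (1 / 2) B (by norm_num))).subset ?_
  rintro g ⟨z, hz, h1, h2⟩
  exact ⟨g • z, ⟨z, hz, rfl⟩, h1, h2, (im_smul_le_max g z).trans (hB ⟨z, hz, rfl⟩)⟩

end ProperlyDiscontinuous
-- An `SL(2, ℤ)`-locally finite family of bump functions.
section Bump

/-- A smooth function supported in a Siegel set and positive on the fundamental domain of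
`SL(2, ℤ)`. -/
def bump (z : ℍ) : ℝ := Real.smoothTransition (1 - z.re ^ 2) * Real.smoothTransition (z.im - 1 / 2)

lemma bump_nonneg (z : ℍ) : 0 ≤ bump z :=
  mul_nonneg (Real.smoothTransition.nonneg _) (Real.smoothTransition.nonneg _)

lemma bump_eq_zero {z : ℍ} (h : ¬(z.re ∈ Set.Icc (-1 : ℝ) 1 ∧ 1 / 2 ≤ z.im)) : bump z = 0 := by
  by_contra hb
  obtain ⟨h1, h2⟩ := mul_ne_zero_iff.1 hb
  refine h ⟨?_, ?_⟩
  · have h3 : 0 < 1 - z.re ^ 2 := by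
      by_contra h4
      exact h1 (Real.smoothTransition.zero_of_nonpos (not_lt.1 h4))
    rw [Set.mem_Icc, ← abs_le, abs_le_one_iff_mul_self_le_one]
    linarith [sq z.re]
  · by_contra h4
    exact h2 (Real.smoothTransition.zero_of_nonpos (by linarith))

lemma bump_pos_of_mem_fd {z : ℍ} (h : z ∈ ModularGroup.fd) : 0 < bump z := by
  -- On the fundamental domain `|Re z| ≤ 1/2` and `Im z ≥ √3/2 > 1/2`, so both factors of `bump`
  -- have positive argument.
  have h1 := ModularGroup.three_le_four_mul_im_sq_of_mem_fd h
  have h2 := z.im_pos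
  have h3 := sq_le_sq' (neg_le_of_abs_le h.2) (le_of_abs_le h.2)
  refine mul_pos (Real.smoothTransition.pos_of_pos ?_) (Real.smoothTransition.pos_of_pos ?_)
  · linarith
  · nlinarith

lemma smooth_bump : SmoothOnH bump := by
  have h : ContDiff ℝ (⊤ : ℕ∞) fun w : ℂ =>
      Real.smoothTransition (1 - w.re ^ 2) * Real.smoothTransition (w.im - 1 / 2) := by
    have h1 : ContDiff ℝ (⊤ : ℕ∞) Complex.re := Complex.reCLM.contDiff
    have h2 : ContDiff ℝ (⊤ : ℕ∞) Complex.im := Complex.imCLM.contDiff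
    exact (Real.smoothTransition.contDiff.comp (contDiff_const.sub (h1.pow 2))).mul
      (Real.smoothTransition.contDiff.comp (h2.sub contDiff_const))
  refine h.contDiffOn.congr fun w hw => ?_
  simp [bump, ofComplex_apply_of_im_pos hw]

lemma eventually_ofComplex {P : ℍ → Prop} {z : ℍ} :
    (∀ᶠ w in 𝓝 (z : ℂ), P (ofComplex w)) ↔ ∀ᶠ w in 𝓝 z, P w := by
  rw [← isOpenEmbedding_coe.map_nhds_eq, Filter.eventually_map]
  simp

/-- Local finiteness: one finite set of translates serves a whole compact neighbourhood, so
`bumpSum` is locally a fixed finite sum. -/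
lemma eventually_bump_eq_zero (z : ℍ) : ∃ s : Finset SL(2, ℤ), ∀ᶠ w in 𝓝 z, ∀ g ∉ s,
    bump (g⁻¹ • w) = 0 := by
  obtain ⟨K, hK, hz⟩ := exists_compact_mem_nhds z
  have h := (finite_smul_mem_siegel hK).preimage (inv_injective.injOn)
  refine ⟨h.toFinset, ?_⟩
  filter_upwards [hz] with w hw g hg
  refine bump_eq_zero fun hb => hg ?_
  rw [Set.Finite.mem_toFinset]
  exact ⟨w, hw, hb⟩

variable {E : Type*} [NormedAddCommGroup E] [NormedSpace ℝ E]

/-- The locally finite sum of the translates of `bump` with coefficients `C`. -/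
def bumpSum (C : SL(2, ℤ) → E) (z : ℍ) : E := ∑ᶠ g : SL(2, ℤ), bump (g⁻¹ • z) • C g

lemma bumpSum_eq_sum (C : SL(2, ℤ) → E) {z : ℍ} {s : Finset SL(2, ℤ)}
    (h : ∀ g ∉ s, bump (g⁻¹ • z) = 0) : bumpSum C z = ∑ g ∈ s, bump (g⁻¹ • z) • C g := by
  refine finsum_eq_sum_of_support_subset _ fun g hg => ?_
  by_contra hs
  exact hg (by beta_reduce; rw [h g hs, zero_smul])

lemma bumpSum_smul (C : SL(2, ℤ) → E) (δ : SL(2, ℤ)) (z : ℍ) :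
    bumpSum C (δ • z) = bumpSum (fun g => C (δ * g)) z := by
  rw [bumpSum, ← finsum_comp_equiv (Equiv.mulLeft δ)]
  simp [bumpSum, mul_smul]

lemma smooth_bumpSum (C : SL(2, ℤ) → E) : SmoothOnH (bumpSum C) := by
  intro w hw
  obtain ⟨s, hs⟩ := eventually_bump_eq_zero ⟨w, hw⟩
  have h : ContDiffAt ℝ (⊤ : ℕ∞)
      (fun w : ℂ => ∑ g ∈ s, bump (g⁻¹ • ofComplex w) • C g) w := by
    refine ContDiffAt.sum fun g _ => ContDiffAt.smul ?_ contDiffAt_const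
    have := smooth_bump.comp_mobius (toReal g⁻¹)
    simp only [toReal_smul] at this
    exact this.contDiffAt (isOpenH.mem_nhds hw)
  refine (h.congr_of_eventuallyEq ?_).contDiffWithinAt
  filter_upwards [eventually_ofComplex.2 hs] with w' hw'
  exact bumpSum_eq_sum C hw'

/-- The translates of the fundamental domain cover the half-plane, so some term is positive. This
permits normalising by the sum. -/
lemma bumpSum_one_pos (z : ℍ) : 0 < bumpSum (fun _ => (1 : ℝ)) z := by
  obtain ⟨g, hg⟩ := ModularGroup.exists_smul_mem_fd z
  obtain ⟨s, hs⟩ := eventually_bump_eq_zero z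
  rw [bumpSum_eq_sum _ hs.self_of_nhds]
  have h0 : 0 < bump (g⁻¹⁻¹ • z) := by simpa using bump_pos_of_mem_fd hg
  refine Finset.sum_pos' (fun g _ => by simpa using bump_nonneg _) ⟨g⁻¹, ?_, by simpa using h0⟩
  by_contra hgs
  exact h0.ne' (hs.self_of_nhds _ hgs)

end Bump

/-! ### Every cocycle is the monodromy of a smooth function. -/

section Surjectivity
open groupCohomology
variable {k N : ℕ}

/-- The `Γ`-component of `g` with respect to a system of representatives of the cosets `Γ \ G`. -/
def cosetPart {G : Type*} [Group G] (Γ : Subgroup G) (g : G) : Γ :=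
  ⟨g * (Quotient.mk (QuotientGroup.rightRel Γ) g).out⁻¹,
    QuotientGroup.rightRel_apply.1 (Quotient.mk_out (s := QuotientGroup.rightRel Γ) g)⟩

lemma cosetPart_mul {G : Type*} [Group G] (Γ : Subgroup G) (δ : Γ) (g : G) :
    cosetPart Γ (δ * g) = δ * cosetPart Γ g := by
  have h : Quotient.mk (QuotientGroup.rightRel Γ) (δ * g) =
      Quotient.mk (QuotientGroup.rightRel Γ) g :=
    Quotient.sound (QuotientGroup.rightRel_apply.2 (by simp))
  exact Subtype.ext (by simp [cosetPart, h, mul_assoc])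

/-- Every `1`-cocycle of `Γ(N)` is the failure of equivariance of a smooth function. -/
lemma exists_smooth_of_cocycle (c : cocycles₁ (GammaRep ℂ k N)) : ∃ F : ℍ → V k ℂ, SmoothOnH F ∧
    ∀ (γ : CongruenceSubgroup.Gamma N) (z : ℍ),
      F ((γ : SL(2, ℤ)) • z) = symRepInt ℂ k γ (F z) + c γ := by
  -- The bumps are indexed by all of `SL(2, ℤ)`, so `c` is extended along coset representatives,
  -- keeping the rule `C (γ g) = γ · C g + c γ`.
  let C : SL(2, ℤ) → V k ℂ := fun g => c (cosetPart (CongruenceSubgroup.Gamma N) g)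
  have hC : ∀ (γ : CongruenceSubgroup.Gamma N) (g : SL(2, ℤ)),
      C (γ * g) = symRepInt ℂ k γ (C g) + c γ := fun γ g => by
    change c (cosetPart _ (γ * g)) = _
    rw [cosetPart_mul]
    exact (mem_cocycles₁_iff (c : _ → _)).1 c.2 _ _
  let ψ : ℍ → ℝ := bumpSum fun _ => (1 : ℝ)
  have hψ : ∀ z, ψ z ≠ 0 := fun z => (bumpSum_one_pos z).ne'
  refine ⟨fun z => (ψ z)⁻¹ • bumpSum C z,
    ContDiffOn.smul (ContDiffOn.inv (smooth_bumpSum _) fun w _ => hψ _) (smooth_bumpSum C),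
    fun γ z => ?_⟩
  obtain ⟨s, hs⟩ := eventually_bump_eq_zero z
  have h1 : ψ ((γ : SL(2, ℤ)) • z) = ψ z := bumpSum_smul _ _ _
  -- The inhomogeneous term is weighted by the total mass `ψ z`; division by the invariant function
  -- `ψ` leaves exactly `c γ`.
  have h2 : bumpSum C ((γ : SL(2, ℤ)) • z) =
      symRepInt ℂ k γ (bumpSum C z) + ψ z • c γ := by
    simp only [ψ, bumpSum_smul, bumpSum_eq_sum _ hs.self_of_nhds, hC, map_sum, Finset.sum_smul,
      smul_add, Finset.sum_add_distrib, smul_eq_mul, mul_one]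
    congr 1
    exact Finset.sum_congr rfl fun g _ =>
      (((symRepInt ℂ k γ).restrictScalars ℝ).map_smul _ _).symm
  beta_reduce
  rw [h1, h2, smul_add, inv_smul_smul₀ (hψ z)]
  congr 1
  exact (((symRepInt ℂ k γ).restrictScalars ℝ).map_smul _ _).symm

end Surjectivity
-- From rational Čech cocycles to rational group cocycles.
section Rationality
open groupCohomology
variable {k N : ℕ}

lemma map_substAlg {R S : Type*} [CommRing R] [CommRing S] (f : R →+* S)
    (g : Matrix (Fin 2) (Fin 2) R) (p : MvPolynomial (Fin 2) R) :
    MvPolynomial.map f (substAlg R g p) = substAlg S (g.map f) (MvPolynomial.map f p) := by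
  have h : (MvPolynomial.map f).comp (substAlg R g).toRingHom =
      (substAlg S (g.map f)).toRingHom.comp (MvPolynomial.map f) :=
    MvPolynomial.ringHom_ext (fun r => by simp [substAlg]) (fun i => by simp [substAlg])
  exact congrArg (fun φ => φ p) h

lemma symRepInt_apply {R : Type*} [CommRing R] (γ : SL(2, ℤ)) (v : V k R) (i : Fin (k + 1)) :
    symRepInt R k γ v i = MvPolynomial.coeff (mon k i)
      (substAlg R (map (Int.castRingHom R) γ).1
        (∑ j, MvPolynomial.monomial (mon k j) (v j))) := rfl

/-- The substitution attached to `γ` has integer coefficients, so it commutes with the base change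
from `ℚ` to `ℂ`. -/
lemma ratToComplex_symRepInt (γ : SL(2, ℤ)) (v : V k ℚ) :
    ratToComplex k (symRepInt ℚ k γ v) = symRepInt ℂ k γ (ratToComplex k v) := by
  funext i
  rw [symRepInt_apply, ratToComplex, symRepInt_apply]
  have h := congrArg (MvPolynomial.coeff (mon k i)) (map_substAlg (Rat.castHom ℂ)
    (map (Int.castRingHom ℚ) γ).1
    (∑ j, MvPolynomial.monomial (mon k j) (v j)))
  have e : (map (Int.castRingHom ℚ) γ).1.map (Rat.castHom ℂ) = (map (Int.castRingHom ℂ) γ).1 := by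
    ext a b
    exact Rat.cast_intCast (γ a b)
  have e' : MvPolynomial.map (Rat.castHom ℂ) (∑ j, MvPolynomial.monomial (mon k j) (v j)) =
      ∑ j, MvPolynomial.monomial (mon k j) (ratToComplex k v j) := by
    simp [ratToComplex]
  rw [MvPolynomial.coeff_map, e, e'] at h
  exact h

variable (k) in
/-- `ratToComplex` as a homomorphism of groups. -/
def ratToComplexHom : V k ℚ →+ V k ℂ where
  toFun := ratToComplex k
  map_zero' := by funext i; simp [ratToComplex]
  map_add' v w := by funext i; simp [ratToComplex]

lemma ratToComplexHom_apply (v : V k ℚ) : ratToComplexHom k v = ratToComplex k v := rfl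

lemma ratToComplexHom_injective : Function.Injective (ratToComplexHom k) := fun _ _ h =>
  funext fun i => Rat.cast_injective (α := ℂ) (congrFun h i)

lemma ratToComplexHom_symRepInt (γ : SL(2, ℤ)) (v : V k ℚ) :
    ratToComplexHom k (symRepInt ℚ k γ v) = symRepInt ℂ k γ (ratToComplexHom k v) :=
  ratToComplex_symRepInt γ v

/-- A cocycle with rational values comes from a cocycle with values in `V_k`. -/
lemma H1π_mem_rationalGroup (c : cocycles₁ (GammaRep ℂ k N))
    (hc : ∀ γ, c γ ∈ (ratToComplexHom k).range) : H1π (GammaRep ℂ k N) c ∈ rationalGroup k N := by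
  obtain ⟨r, hr⟩ : ∃ r : CongruenceSubgroup.Gamma N → V k ℚ, ∀ γ, ratToComplexHom k (r γ) = c γ :=
    Classical.axiom_of_choice hc
  have hr' : r ∈ cocycles₁ (GammaRep ℚ k N) := by
    refine (mem_cocycles₁_iff (A := GammaRep ℚ k N) r).2 fun γ δ => ?_
    change r (γ * δ) = symRepInt ℚ k γ (r δ) + r γ
    refine ratToComplexHom_injective ?_
    rw [map_add, ratToComplexHom_symRepInt, hr, hr, hr]
    exact (mem_cocycles₁_iff (c : _ → _)).1 c.2 γ δ
  exact ⟨⟨r, hr'⟩, c, fun γ => (hr γ).symm, rfl⟩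

lemma eventually_sub_eq {U : Set ℍ} (hU : IsOpen U) {ω : OneForm k} {F f : ℍ → V k ℂ}
    (hF : IsPrimitive ω F)
    (hf : ∀ z ∈ U, HasFDerivAt (fun w : ℂ => f (ofComplex w)) (ω z) z) {z : ℍ} (hz : z ∈ U) :
    ∀ᶠ w in 𝓝 z, F w - f w = F z - f z := by
  have h1 := (eventually_ofComplex.2 (hU.mem_nhds hz)).and (isOpenH.mem_nhds z.im_pos)
  obtain ⟨ε, hε, hb⟩ := Metric.eventually_nhds_iff_ball.1 h1
  have hd : ∀ w ∈ Metric.ball (z : ℂ) ε,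
      HasFDerivAt (𝕜 := ℝ) (fun w : ℂ => F (ofComplex w) - f (ofComplex w)) 0 w := by
    intro w hw
    obtain ⟨hwU, hwp⟩ := hb w hw
    have h2 := hf _ hwU
    rw [ofComplex_apply_of_im_pos hwp] at h2
    have h3 := (hF ⟨w, hwp⟩).fun_sub h2
    rwa [sub_self] at h3
  rw [← eventually_ofComplex (P := fun w => F w - f w = F z - f z)]
  filter_upwards [Metric.ball_mem_nhds (z : ℂ) hε] with w hw
  have h := Metric.isOpen_ball.is_const_of_fderiv_eq_zero (𝕜 := ℝ)
    (f := fun w : ℂ => F (ofComplex w) - f (ofComplex w)) (convex_ball (z : ℂ) ε).isPreconnected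
    (fun w hw => (hd w hw).differentiableAt.differentiableWithinAt)
    (fun w hw => (hd w hw).fderiv) hw (Metric.mem_ball_self hε)
  simpa using h

/-- A class given by a rational Čech cocycle has a rational period cocycle. -/
lemma CechCocycle.Represents.mem_rationalGroup {c : CechCocycle k N} {ω : OneForm k}
    (h : c.Represents ω) (hω : ω ∈ Z1 k N) (z₀ : ℍ) :
    H1π (GammaRep ℂ k N) ⟨periodCochain k N z₀ ω, periodCochain_mem hω z₀⟩ ∈
      rationalGroup k N := by
  obtain ⟨f, hf, heq, hdiff⟩ := h
  obtain ⟨F, hF⟩ : ∃ F, IsPrimitive ω F := exists_primitive hω.1 hω.2.1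
  set R := (ratToComplexHom k).range
  have hxy : ∀ x y, ∀ z ∈ c.U x ∩ c.U y, (F z - f x z) - (F z - f y z) ∈ R := fun x y z hz =>
    ⟨c.q x y z, by rw [ratToComplexHom_apply, ← hdiff x y z hz]; abel⟩
  -- The index of the local primitive moves with the point. Modulo `R` its choice is irrelevant by
  -- `hxy`, so near `z` one may keep the index `z`, for which the difference is constant.
  have hloc : IsLocallyConstant fun z => (QuotientAddGroup.mk (F z - f z z) : V k ℂ ⧸ R) := by
    rw [IsLocallyConstant.iff_eventually_eq]
    intro z
    filter_upwards [eventually_sub_eq (c.isOpen_U z) hF (hf z) (c.mem_U z),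
      (c.isOpen_U z).mem_nhds (c.mem_U z)] with w hw hwz
    rw [QuotientAddGroup.eq_iff_sub_mem, ← hw]
    exact hxy w z w ⟨c.mem_U w, hwz⟩
  set v := F z₀ - f z₀ z₀
  have hv : ∀ γ : CongruenceSubgroup.Gamma N,
      monodromy F z₀ γ + (symRepInt ℂ k γ v - v) ∈ R := by
    intro γ
    set z := (γ : SL(2, ℤ)) • z₀
    have hz : z ∈ c.U z₀ := c.smul_mem_U _ _ γ.2 _ (c.mem_U z₀)
    have h1 : (F z - f z z) - v ∈ R := by
      rw [← QuotientAddGroup.eq_iff_sub_mem]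
      exact hloc.apply_eq_of_isPreconnected isPreconnected_univ (Set.mem_univ z) (Set.mem_univ z₀)
    -- Hence `F (γ z₀) - f z₀ (γ z₀)` is `v` modulo `R`; equivariance of `f z₀` rewrites the left
    -- side as the monodromy plus `γ · v`.
    have h2 := R.add_mem (hxy z₀ z z ⟨hz, c.mem_U z⟩) h1
    have h3 : f z₀ z = symRepInt ℂ k γ (f z₀ z₀) := heq z₀ γ γ.2 z₀ (c.mem_U z₀)
    convert h2 using 1
    rw [h3, monodromy, map_sub]
    abel
  have hb : (fun γ : CongruenceSubgroup.Gamma N => symRepInt ℂ k γ v - v) ∈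
      coboundaries₁ (GammaRep ℂ k N) := mem_coboundaries₁_iff.2 ⟨v, fun _ => rfl⟩
  have e : H1π (GammaRep ℂ k N) ⟨periodCochain k N z₀ ω, periodCochain_mem hω z₀⟩ =
      H1π (GammaRep ℂ k N) (⟨monodromy F z₀, hF.monodromy_mem hω.2.2 z₀⟩ +
        ⟨_, coboundaries₁_le_cocycles₁ _ hb⟩) := by
    rw [H1π_periodCochain hω hF z₀, map_add, left_eq_add, H1π_eq_zero_iff]
    exact hb
  rw [e]
  exact H1π_mem_rationalGroup _ hv

end Rationality

/-! ### From rational group cocycles to rational Čech cocycles. -/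

section Cech
open groupCohomology
variable {k N : ℕ} (W : ℍ → Set ℍ)

variable (N) in
/-- The `Γ(N)`-stable set generated by `W x`. -/
def orbitSet (x : ℍ) : Set ℍ :=
  {z | ∃ γ : CongruenceSubgroup.Gamma N, (γ : SL(2, ℤ))⁻¹ • z ∈ W x}

open Classical in
variable (N) in
/-- An element of `Γ(N)` carrying a point of `W x` to `z`. -/
def sheet (x z : ℍ) : CongruenceSubgroup.Gamma N :=
  if h : z ∈ orbitSet N W x then h.choose else 1

variable {W}

lemma sheet_spec {x z : ℍ} (h : z ∈ orbitSet N W x) :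
    (sheet N W x z : SL(2, ℤ))⁻¹ • z ∈ W x := by
  rw [sheet, dif_pos h]
  exact h.choose_spec

/-- Two candidates differ by an element carrying a point of `W x` into `W x`, which `hW` makes
trivial. Equivariance and local constancy of the sheet index follow from this uniqueness. -/
lemma sheet_eq (hW : ∀ x, ∀ γ ∈ CongruenceSubgroup.Gamma N, ∀ w ∈ W x, γ • w ∈ W x → γ = 1)
    {x z : ℍ} {γ : CongruenceSubgroup.Gamma N} (h : (γ : SL(2, ℤ))⁻¹ • z ∈ W x) :
    sheet N W x z = γ := by
  have h1 : (γ⁻¹ * sheet N W x z : CongruenceSubgroup.Gamma N) = 1 := by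
    refine Subtype.ext (hW x _ (γ⁻¹ * sheet N W x z).2 _ (sheet_spec ⟨γ, h⟩) ?_)
    simpa only [Subgroup.coe_mul, Subgroup.coe_inv, mul_smul, smul_inv_smul] using h
  exact (inv_mul_eq_one.1 h1).symm

lemma isOpen_orbitSet (ho : ∀ x, IsOpen (W x)) (x : ℍ) : IsOpen (orbitSet N W x) := by
  have h : orbitSet N W x =
      ⋃ γ : CongruenceSubgroup.Gamma N, ((γ : SL(2, ℤ))⁻¹ • ·) ⁻¹' W x := by
    ext z; simp [orbitSet]
  rw [h]
  exact isOpen_iUnion fun γ => (ho x).preimage (continuous_const_smul ((γ : SL(2, ℤ))⁻¹))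

lemma smul_mem_orbitSet {x z : ℍ} (γ : CongruenceSubgroup.Gamma N) (h : z ∈ orbitSet N W x) :
    (γ : SL(2, ℤ)) • z ∈ orbitSet N W x := by
  obtain ⟨δ, hδ⟩ := h
  exact ⟨γ * δ, by simpa only [Subgroup.coe_mul, mul_inv_rev, mul_smul, inv_smul_smul] using hδ⟩

lemma sheet_smul (hW : ∀ x, ∀ γ ∈ CongruenceSubgroup.Gamma N, ∀ w ∈ W x, γ • w ∈ W x → γ = 1)
    {x z : ℍ} (γ : CongruenceSubgroup.Gamma N) (h : z ∈ orbitSet N W x) :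
    sheet N W x ((γ : SL(2, ℤ)) • z) = γ * sheet N W x z := by
  refine sheet_eq hW ?_
  simpa only [Subgroup.coe_mul, mul_inv_rev, mul_smul, inv_smul_smul] using sheet_spec h

lemma eventually_sheet_eq (ho : ∀ x, IsOpen (W x))
    (hW : ∀ x, ∀ γ ∈ CongruenceSubgroup.Gamma N, ∀ w ∈ W x, γ • w ∈ W x → γ = 1)
    {x z : ℍ} (h : z ∈ orbitSet N W x) : ∀ᶠ w in 𝓝 z, sheet N W x w = sheet N W x z := by
  have h1 := (continuous_const_smul (T := ℍ) ((sheet N W x z : SL(2, ℤ))⁻¹)).continuousAt.preimage_mem_nhds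
    ((ho x).mem_nhds (sheet_spec h))
  filter_upwards [h1] with w hw
  exact sheet_eq hW hw

/-- The Čech cocycle of a rational group cocycle, for a cover by evenly covered sets. -/
def cechOfCocycle (ho : ∀ x, IsOpen (W x)) (hm : ∀ x, x ∈ W x)
    (hW : ∀ x, ∀ γ ∈ CongruenceSubgroup.Gamma N, ∀ w ∈ W x, γ • w ∈ W x → γ = 1)
    (c : cocycles₁ (GammaRep ℚ k N)) : CechCocycle k N where
  U := orbitSet N W
  isOpen_U := isOpen_orbitSet ho
  mem_U x := ⟨1, by simpa using hm x⟩
  smul_mem_U x γ hγ z hz := smul_mem_orbitSet ⟨γ, hγ⟩ hz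
  q x y z := c (sheet N W x z) - c (sheet N W y z)
  locallyConst x y z hz := by
    filter_upwards [eventually_sheet_eq ho hW hz.1, eventually_sheet_eq ho hW hz.2] with w h1 h2
    rw [h1, h2]
  equivariant x y γ hγ z hz := by
    have h := (mem_cocycles₁_iff (c : _ → _)).1 c.2
    have h1 := sheet_smul hW ⟨γ, hγ⟩ hz.1
    have h2 := sheet_smul hW ⟨γ, hγ⟩ hz.2
    dsimp only at h1 h2
    -- Both terms acquire the same summand `c γ`, which cancels in the difference.
    rw [h1, h2, h, h, add_sub_add_right_eq_sub, ← map_sub]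
    rfl
  cocycle x y t z _ := by abel

/-- On the set attached to `x`, `F` is corrected by the cocycle at the sheet index. The correction
is locally constant, so the differential is unchanged, and it has the same defect of equivariance as
`F`. -/
lemma cechOfCocycle_represents (ho : ∀ x, IsOpen (W x)) (hm : ∀ x, x ∈ W x)
    (hW : ∀ x, ∀ γ ∈ CongruenceSubgroup.Gamma N, ∀ w ∈ W x, γ • w ∈ W x → γ = 1)
    (c : cocycles₁ (GammaRep ℚ k N)) {F : ℍ → V k ℂ} (hF : SmoothOnH F)
    (hFc : ∀ (γ : CongruenceSubgroup.Gamma N) (z : ℍ),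
      F ((γ : SL(2, ℤ)) • z) = symRepInt ℂ k γ (F z) + ratToComplex k (c γ)) :
    (cechOfCocycle ho hm hW c).Represents (extD k F) := by
  refine ⟨fun x z => F z - ratToComplex k (c (sheet N W x z)), fun x z hz => ?_,
    fun x γ hγ z hz => ?_, fun x y z _ => ?_⟩
  · refine ((hF.isPrimitive_extD z).sub_const
      (ratToComplex k (c (sheet N W x z)))).congr_of_eventuallyEq ?_
    filter_upwards [eventually_ofComplex.2 (eventually_sheet_eq ho hW hz)] with w hw
    rw [hw]
  · have h := (mem_cocycles₁_iff (c : _ → _)).1 c.2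
    have h1 := sheet_smul hW ⟨γ, hγ⟩ hz
    have h2 := hFc ⟨γ, hγ⟩ z
    dsimp only at h1 h2 ⊢
    have h3 : ratToComplex k (c (⟨γ, hγ⟩ * sheet N W x z)) =
        symRepInt ℂ k γ (ratToComplex k (c (sheet N W x z))) + ratToComplex k (c ⟨γ, hγ⟩) := by
      rw [h, ← ratToComplex_symRepInt]
      exact map_add (ratToComplexHom k) _ _
    rw [h1, h2, h3, map_sub]
    abel
  · have h : ratToComplex k (c (sheet N W x z) - c (sheet N W y z)) =
        ratToComplex k (c (sheet N W x z)) - ratToComplex k (c (sheet N W y z)) :=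
      map_sub (ratToComplexHom k) _ _
    change _ = ratToComplex k (c (sheet N W x z) - c (sheet N W y z))
    rw [h]
    exact sub_sub_sub_cancel_left _ _ _

end Cech

/-! ### The period isomorphism, its equivariance and its rationality. -/

section Comparison
open groupCohomology
variable (k N : ℕ)

/-- One inclusion makes the map on the quotient well defined, the other makes it injective. -/
lemma B1_eq_ker (z₀ : ℍ) :
    B1 k N = LinearMap.ker ((H1π (GammaRep ℂ k N)).hom ∘ₗ periodMap k N z₀) := by
  ext ω
  rw [LinearMap.mem_ker]
  refine Iff.trans ?_ (H1π_eq_zero_iff (periodMap k N z₀ ω)).symm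
  refine ⟨?_, mem_B1_of_periodCochain_mem⟩
  rintro ⟨f, hf, hi, e⟩
  change periodCochain k N z₀ ω ∈ _
  rw [e]
  exact periodCochain_extD_mem hf hi z₀

lemma H1π_periodMap_extD (z₀ : ℍ) {c : cocycles₁ (GammaRep ℂ k N)} {F : ℍ → V k ℂ}
    (hF : SmoothOnH F) (hc : ∀ (γ : CongruenceSubgroup.Gamma N) (z : ℍ),
      F ((γ : SL(2, ℤ)) • z) = symRepInt ℂ k γ (F z) + c γ) :
    H1π (GammaRep ℂ k N) (periodMap k N z₀ ⟨extD k F, extD_mem_Z1 hF c hc⟩) =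
      H1π (GammaRep ℂ k N) c := by
  refine (H1π_periodCochain (extD_mem_Z1 hF c hc) hF.isPrimitive_extD z₀).trans ?_
  refine congrArg _ (cocycles₁_ext fun γ => ?_)
  change F _ - _ = _
  rw [hc, add_sub_cancel_left]

/-- The isomorphism between de Rham and group cohomology induced by `ω ↦ S_ω`. -/
def periodEquiv (z₀ : ℍ) : H1dR k N ≃ₗ[ℂ] H1Gamma ℂ k N :=
  LinearEquiv.ofBijective
    ((B1 k N).liftQ ((H1π (GammaRep ℂ k N)).hom ∘ₗ periodMap k N z₀) (B1_eq_ker k N z₀).le) <| by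
    constructor
    · rw [← LinearMap.ker_eq_bot]
      exact Submodule.ker_liftQ_eq_bot _ _ _ (B1_eq_ker k N z₀).ge
    · intro x
      induction x using H1_induction_on with | @h c =>
      obtain ⟨F, hF, hc⟩ := exists_smooth_of_cocycle c
      exact ⟨Submodule.Quotient.mk ⟨extD k F, extD_mem_Z1 hF c hc⟩,
        H1π_periodMap_extD k N z₀ hF hc⟩

lemma periodEquiv_mk (z₀ : ℍ) (ω : Z1 k N) :
    periodEquiv k N z₀ (Submodule.Quotient.mk ω) =
      H1π (GammaRep ℂ k N) ⟨periodCochain k N z₀ ω, periodCochain_mem ω.2 z₀⟩ := rfl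

lemma monodromy_funRep {ω : OneForm k} {F : ℍ → V k ℂ} (hi : IsInvariantForm k N ω)
    (hF : IsPrimitive ω F) (g : SL(2, ℤ)) (z : ℍ) (γ : CongruenceSubgroup.Gamma N) :
    monodromy (funRep k (toReal g) F) z γ = symRepInt ℂ k g (monodromy F z (conjInv N g γ)) := by
  -- With the base point moved to `g⁻¹ z`, both sides become `g · F (g⁻¹ γ z) - γ g · F (g⁻¹ z)`.
  rw [hF.monodromy_eq hi z (g⁻¹ • z), monodromy, monodromy, funRep_toReal_apply,
    funRep_toReal_apply, coe_conjInv, map_sub]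
  simp only [← Module.End.mul_apply, ← map_mul, ← mul_smul]
  simp [mul_assoc]

lemma periodEquiv_equivariant (z₀ : ℍ) (g : SL(2, ZMod N)) (x : H1dR k N) :
    periodEquiv k N z₀ (H1dRRep k N g x) = H1GammaRep k N g (periodEquiv k N z₀ x) := by
  obtain ⟨g, rfl⟩ := reduction_surjective N g
  obtain ⟨ω, rfl⟩ := Submodule.Quotient.mk_surjective _ x
  obtain ⟨F, hF⟩ : ∃ F, IsPrimitive (ω : OneForm k) F := exists_primitive ω.2.1 ω.2.2.1
  have hgF : IsPrimitive (Z1Rep k N g ω : OneForm k) (funRep k (toReal g) F) :=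
    hasFDerivAt_funRep hF (toReal g)
  rw [H1dRRep, H1GammaRep, descend_reduction, descend_reduction]
  change periodEquiv k N z₀ (Submodule.Quotient.mk (Z1Rep k N g ω)) = H1GammaAct ℂ k N g _
  rw [periodEquiv_mk, periodEquiv_mk, H1π_periodCochain (Z1Rep k N g ω).2 hgF,
    H1π_periodCochain ω.2 hF, H1GammaAct_π]
  refine congrArg _ (cocycles₁_ext fun γ => ?_)
  rw [cocycleAct_apply]
  exact monodromy_funRep k N ω.2.2.2 hF g z₀ γ

lemma periodEquiv_rational (hN : 3 ≤ N) (z₀ : ℍ) :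
    periodEquiv k N z₀ '' rationalDeRham k N = rationalGroup k N := by
  refine Set.Subset.antisymm ?_ ?_
  · rintro _ ⟨_, ⟨ω, c, rfl, hc⟩, rfl⟩
    exact hc.mem_rationalGroup ω.2 z₀
  · rintro _ ⟨c, c', h, rfl⟩
    obtain ⟨F, hF, hFc⟩ := exists_smooth_of_cocycle c'
    -- Freeness, hence `N ≥ 3`, enters only in this inclusion, to provide evenly covered sets.
    choose W ho hm hW using exists_nhds_smul_mem hN
    refine ⟨_, ⟨⟨extD k F, extD_mem_Z1 hF c' hFc⟩, cechOfCocycle ho hm hW c, rfl,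
      cechOfCocycle_represents ho hm hW c hF fun γ z => ?_⟩, H1π_periodMap_extD k N z₀ hF hFc⟩
    rw [hFc, h]

end Comparison
end SymCoh
end
open SymCoh groupCohomology in
theorem mainTheorem11 (k N : ℕ) (hN : 3 ≤ N) (z₀ : ℍ) :
    (∀ ω : OneForm k, SmoothOnH ω → ClosedForm k ω → ∀ (a b : ℍ) (p : Path (a : ℂ) (b : ℂ)),
      (∀ t, 0 < (p t).im) → ContDiffOn ℝ 1 p.extend (Set.Icc 0 1) →
      curveIntegral (fun w : ℂ => ω (ofComplex w)) p = formIntegral k ω a b) ∧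
    (∀ ω ∈ Z1 k N, periodCochain k N z₀ ω ∈ cocycles₁ (GammaRep ℂ k N)) ∧
    (∀ f : ℍ → V k ℂ, SmoothOnH f → IsInvariantFun k N f →
      periodCochain k N z₀ (extD k f) ∈ coboundaries₁ (GammaRep ℂ k N)) ∧
    ∃ S : H1dR k N ≃ₗ[ℂ] H1Gamma ℂ k N,
      (∀ (ω : Z1 k N) (hω : periodCochain k N z₀ ω ∈ cocycles₁ (GammaRep ℂ k N)),
        S (Submodule.Quotient.mk ω) = H1π (GammaRep ℂ k N) ⟨periodCochain k N z₀ ω, hω⟩) ∧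
      (∀ (g : SL(2, ZMod N)) (x : H1dR k N), S (H1dRRep k N g x) = H1GammaRep k N g (S x)) ∧
      S '' rationalDeRham k N = rationalGroup k N := by
  refine ⟨fun ω hω hc a b p hp hd => ?_, fun ω hω => periodCochain_mem hω z₀,
    fun f hf hi => periodCochain_extD_mem hf hi z₀, periodEquiv k N z₀,
    fun ω _ => periodEquiv_mk k N z₀ ω, periodEquiv_equivariant k N z₀,
    periodEquiv_rational k N hN z₀⟩
  obtain ⟨F, hF⟩ : ∃ F, IsPrimitive ω F := exists_primitive hω hc
  rw [hF.curveIntegral_eq_sub hω p hp hd, hF.formIntegral_eq_sub hω]
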